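/- Let $\mathrm{LO}\subseteq 2^{\mathbb N\times\mathbb N}$ be the Polish space of (codes for) reflexive linear orders on $\mathbb N$, and let $\cong_{\mathrm{LO}}$ be isomorphism on $\mathrm{LO}$. For linear orders, $L\trianglelefteq L'$ means that there is an order embedding of $L$ into $L'$ with convex range. Convex biembeddability is the equivalence relation on $\mathrm{LO}$ given by $L\mathrel{\underline{\bowtie}_{\mathrm{LO}}}L'\iff L\trianglelefteq L'$ and $L'\trianglelefteq L$. A linear order $L$ is right compressible if $L=L'+R$ with $L'\cong L$ and $R\neq\emptyset$, and left compressible if $L=R+L'$ with $L'\cong L$ and $R\neq\emptyset$. Let $\mathrm{LO}_r,\mathrm{LO}_l\subseteq\mathrm{LO}$ be the sets of right, respectively left, compressible orders. For equivalence relations $E$ on $X$ and $F$ on $Y$ and $A\subseteq X$: a map $\varphi\colon X\to Y$ reduces $E\restriction A$ to $F$ if $x\mathrel{E}y\iff\varphi(x)\mathrel{F}\varphi(y)$ for all $x,y\in A$, and it reduces $E$ to $F$ if this holds with $A=X$; write $\leq_B$ (Borel reducible) if there is such a Borel map defined on $X$, where $X,Y$ are standard Borel spaces, and $E\leq_{\mathit{Baire}}F$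 (Baire reducible) if, for topological spaces $X,Y$, some reduction of $E$ to $F$ is such that the preimage of every Borel set has the Baire property. The jump $E^+$ is the equivalence relation on $X^{\mathbb N}$ given by $(x_n)\mathrel{E^+}(y_n)\iff\{[x_n]_E:n\in\mathbb N\}=\{[y_n]_E:n\in\mathbb N\}$. An equivalence relation $E$ on a Polish space $X$ is $\sigma$-classifiable by countable structures if $X$ is a countable disjoint union of $E$-invariant sets $X_i$ with the Baire property such that each $E\restriction X_i$ is Borel reducible to isomorphism of graphs with vertex set $\mathbb N$. Then: 1. $\underline{\bowtie}_{\mathrm{LO}}$ is $\sigma$-classifiable by countable structures, and $\underline{\bowtie}_{\mathrm{LO}}\leq_{\mathit{Baire}}{\cong_{\mathrm{LO}}}$. 2. The four sets $\mathrm{LO}\setminus(\mathrm{LO}_r\cup\mathrm{LO}_l)$ (incompressible), $\mathrm{LO}_l\setminus\mathrm{LO}_r$ (left-only), $\mathrm{LO}_r\setminus\mathrm{LO}_l$ (right-only) and $\mathrm{LO}_r\cap\mathrm{LO}_l$ (bicompressible) form a partition of $\mathrm{LO}$ into nonempty $\underline{\bowtie}_{\mathrm{LO}}$-invariant sets with the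 Baire property. 3. On $\mathrm{LO}\setminus(\mathrm{LO}_r\cup\mathrm{LO}_l)$ the relations $\underline{\bowtie}_{\mathrm{LO}}$ and $\cong_{\mathrm{LO}}$ coincide, so that the restriction of $\underline{\bowtie}_{\mathrm{LO}}$ to this set is Borel reducible to $\cong_{\mathrm{LO}}$ via the identity map. 4. The restrictions of $\underline{\bowtie}_{\mathrm{LO}}$ to $\mathrm{LO}_r\cap\mathrm{LO}_l$, $\mathrm{LO}_l\setminus\mathrm{LO}_r$ and $\mathrm{LO}_r\setminus\mathrm{LO}_l$ are Borel reducible to $(\cong_{\mathrm{LO}})^+$. Moreover, in each case the reduction can be chosen to be a Borel map $\varphi\colon\mathrm{LO}\to\mathrm{LO}^{\mathbb N}$ such that, for every $L\in\mathrm{LO}$ having at least one infinite interval $[n,m]_L$ (respectively infinite ray $[n,+\infty)_L$, infinite ray $(-\infty,n]_L$), the sequence $\varphi(L)$ enumerates, up to isomorphism and possibly with repetitions, exactly the infinite intervals $[n,m]_L$ (respectively rays $[n,+\infty)_L$, rays $(-\infty,n]_L$) of $L$. 5. $(\cong_{\mathrm{LO}})^+\leq_B{\cong_{\mathrm{LO}}}$;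 hence each of the three restrictions in 4 is also Borel reducible to $\cong_{\mathrm{LO}}$. -/

import Mathlib

namespace CvxBiembed

open Set

/-! ### Borel and Baire reducibility of equivalence relations -/

section Reducibility

/-- `φ` is a Borel reduction of the restriction of `E` to `A` to the relation `F`. -/
def IsBorelReductionOn {X Y : Type*} [MeasurableSpace X] [StandardBorelSpace X]
    [MeasurableSpace Y] [StandardBorelSpace Y]
    (A : Set X) (E : Setoid X) (F : Setoid Y) (φ : X → Y) : Prop :=
  Measurable φ ∧ ∀ x ∈ A, ∀ y ∈ A, E x y ↔ F (φ x) (φ y)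

/-- The restriction of `E` to `A` is Borel reducible to `F`. -/
def BorelReducibleOn {X Y : Type*} [MeasurableSpace X] [StandardBorelSpace X]
    [MeasurableSpace Y] [StandardBorelSpace Y]
    (A : Set X) (E : Setoid X) (F : Setoid Y) : Prop :=
  ∃ φ : X → Y, IsBorelReductionOn A E F φ

/-- `E` is Borel reducible to `F`. -/
def BorelReducible {X Y : Type*} [MeasurableSpace X] [StandardBorelSpace X]
    [MeasurableSpace Y] [StandardBorelSpace Y] (E : Setoid X) (F : Setoid Y) : Prop :=
  ∃ φ : X → Y, Measurable φ ∧ ∀ x y, E x y ↔ F (φ x) (φ y)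

/-- `E` is Baire reducible to `F`: there is a reduction `φ` such that the preimages under `φ` of
Borel sets have the Baire property. -/
def BaireReducible {X Y : Type*} [TopologicalSpace X] [TopologicalSpace Y]
    (E : Setoid X) (F : Setoid Y) : Prop :=
  ∃ φ : X → Y, (∀ B : Set Y, @MeasurableSet Y (borel Y) B → BaireMeasurableSet (φ ⁻¹' B)) ∧
    ∀ x y, E x y ↔ F (φ x) (φ y)

/-- `A` is closed under the equivalence relation `E`. -/
def ClosedUnder {X : Type*} (E : Setoid X) (A : Set X) : Prop :=
  ∀ x ∈ A, ∀ y, E y x → y ∈ A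

/-- The Friedman–Stanley jump of `E`: two sequences are related when they enumerate the same set
of `E`-classes. -/
def jump {X : Type*} (E : Setoid X) : Setoid (ℕ → X) where
  r x y := range (fun n => Quotient.mk E (x n)) = range (fun n => Quotient.mk E (y n))
  iseqv := ⟨fun _ => rfl, fun h => h.symm, fun h h' => h.trans h'⟩

end Reducibility

/-! ### The Polish space of countable graphs -/

/-- Codes for (simple, undirected) graphs with vertex set `ℕ`. -/
def GRAPH : Set (ℕ × ℕ → Bool) :=
  {G | (∀ n, G (n, n) = false) ∧ ∀ n m, G (n, m) = true → G (m, n) = true}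

theorem isClosed_GRAPH : IsClosed GRAPH := by
  have h : ∀ p : ℕ × ℕ, Continuous fun G : ℕ × ℕ → Bool => G p := fun p => continuous_apply p
  have hE : GRAPH = (⋂ n, (fun G : ℕ × ℕ → Bool => G (n, n)) ⁻¹' {false}) ∩
      ⋂ n, ⋂ m, (fun G : ℕ × ℕ → Bool => (G (n, m), G (m, n))) ⁻¹'
        {q | q.1 = true → q.2 = true} := by
    ext G; simp [GRAPH]
  rw [hE]
  refine IsClosed.inter (isClosed_iInter fun n => (isClosed_discrete _).preimage (h _)) ?_
  exact isClosed_iInter fun n => isClosed_iInter fun m =>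
    (isClosed_discrete _).preimage ((h _).prodMk (h _))

instance : PolishSpace GRAPH := by
  have : PolishSpace Bool := inferInstance
  exact isClosed_GRAPH.polishSpace

/-- The graph on `ℕ` coded by `G`. -/
def toGraph (G : GRAPH) : SimpleGraph ℕ where
  Adj n m := G.1 (n, m) = true
  symm := ⟨fun n m => G.2.2 n m⟩
  loopless := ⟨fun n h => by simp [G.2.1 n] at h⟩

/-- Isomorphism of countable graphs. -/
def isoGRAPH : Setoid GRAPH where
  r G H := Nonempty (toGraph G ≃g toGraph H)
  iseqv := ⟨fun _ => ⟨RelIso.refl _⟩, fun ⟨f⟩ => ⟨f.symm⟩, fun ⟨f⟩ ⟨g⟩ => ⟨f.trans g⟩⟩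

/-- `E` is σ-classifiable by countable structures: the space is covered by countably many pairwise
disjoint `E`-invariant sets with the Baire property, on each of which `E` is Borel reducible to
isomorphism of countable graphs. -/
def SigmaClassifiable {X : Type*} [TopologicalSpace X] [PolishSpace X] [MeasurableSpace X]
    [BorelSpace X] (E : Setoid X) : Prop :=
  ∃ (I : Type) (_ : Countable I) (P : I → Set X),
    Pairwise (fun i j => Disjoint (P i) (P j)) ∧ (⋃ i, P i) = univ ∧
    ∀ i, ClosedUnder E (P i) ∧ BaireMeasurableSet (P i) ∧ BorelReducibleOn (P i) E isoGRAPH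

/-! ### Convex embeddability and compressibility of linear orders -/

section Convex

/-- `α` is convexly embeddable into `β`: there is an order embedding whose range is convex. -/
def CvxEmb (α β : Type*) [LinearOrder α] [LinearOrder β] : Prop :=
  ∃ f : α ↪o β, (range f).OrdConnected

/-- `α = L' + R` with `L' ≅ α` and `R` nonempty. -/
def RightCompressible (α : Type*) [LinearOrder α] : Prop :=
  ∃ s : Set α, IsLowerSet s ∧ sᶜ.Nonempty ∧ Nonempty (s ≃o α)

/-- `α = R + L'` with `L' ≅ α` and `R` nonempty. -/
def LeftCompressible (α : Type*) [LinearOrder α] : Prop :=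
  ∃ s : Set α, IsUpperSet s ∧ sᶜ.Nonempty ∧ Nonempty (s ≃o α)

theorem CvxEmb.trans {α β γ : Type*} [LinearOrder α] [LinearOrder β] [LinearOrder γ]
    (h : CvxEmb α β) (h' : CvxEmb β γ) : CvxEmb α γ := by
  obtain ⟨f, hf⟩ := h
  obtain ⟨g, hg⟩ := h'
  refine ⟨f.trans g, ⟨?_⟩⟩
  rintro _ ⟨a, rfl⟩ _ ⟨b, rfl⟩ z hz
  obtain ⟨y, rfl⟩ := hg.out (mem_range_self (f a)) (mem_range_self (f b)) hz
  obtain ⟨x, rfl⟩ := hf.out (mem_range_self a) (mem_range_self b)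
    ⟨g.le_iff_le.1 hz.1, g.le_iff_le.1 hz.2⟩
  exact ⟨x, rfl⟩

end Convex

/-! ### The Polish space of linear orders on `ℕ` -/

/-- Codes for (reflexive) linear orders on `ℕ`. -/
def LO : Set (ℕ × ℕ → Bool) :=
  {L | (∀ n, L (n, n) = true) ∧
    (∀ n m k, L (n, m) = true → L (m, k) = true → L (n, k) = true) ∧
    (∀ n m, L (n, m) = true → L (m, n) = true → n = m) ∧
    ∀ n m, L (n, m) = true ∨ L (m, n) = true}

theorem isClosed_LO : IsClosed LO := by
  have h : ∀ p : ℕ × ℕ, Continuous fun L : ℕ × ℕ → Bool => L p := fun p => continuous_apply p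
  have hE : LO = (⋂ n, (fun L : ℕ × ℕ → Bool => L (n, n)) ⁻¹' {true}) ∩
      ((⋂ n, ⋂ m, ⋂ k, (fun L : ℕ × ℕ → Bool => (L (n, m), L (m, k), L (n, k))) ⁻¹'
        {q | q.1 = true → q.2.1 = true → q.2.2 = true}) ∩
      ((⋂ n, ⋂ m, (fun L : ℕ × ℕ → Bool => (L (n, m), L (m, n))) ⁻¹'
        {q | q.1 = true → q.2 = true → n = m}) ∩
      ⋂ n, ⋂ m, (fun L : ℕ × ℕ → Bool => (L (n, m), L (m, n))) ⁻¹'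
        {q | q.1 = true ∨ q.2 = true})) := by
    ext L; simp [LO]
  rw [hE]
  refine IsClosed.inter ?_ (IsClosed.inter ?_ (IsClosed.inter ?_ ?_))
  · exact isClosed_iInter fun n => (isClosed_discrete _).preimage (h _)
  · exact isClosed_iInter fun n => isClosed_iInter fun m => isClosed_iInter fun k =>
      (isClosed_discrete _).preimage ((h _).prodMk ((h _).prodMk (h _)))
  · exact isClosed_iInter fun n => isClosed_iInter fun m =>
      (isClosed_discrete _).preimage ((h _).prodMk (h _))
  · exact isClosed_iInter fun n => isClosed_iInter fun m =>
      (isClosed_discrete _).preimage ((h _).prodMk (h _))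

instance : PolishSpace LO := by
  have : PolishSpace Bool := inferInstance
  exact isClosed_LO.polishSpace

/-- The underlying set `ℕ` of the linear order coded by `L`, carrying that linear order (and not
the usual order of `ℕ`). -/
def Dom (_ : LO) : Type := ℕ

instance (L : LO) : LinearOrder (Dom L) where
  le n m := L.1 (n, m) = true
  le_refl n := L.2.1 n
  le_trans n m k := L.2.2.1 n m k
  le_antisymm n m := L.2.2.2.1 n m
  le_total n m := L.2.2.2.2 n m
  toDecidableLE n m := inferInstanceAs (Decidable (L.1 (n, m) = true))

/-- Isomorphism on `LO`. -/
def isoLO : Setoid LO where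
  r L M := Nonempty (Dom L ≃o Dom M)
  iseqv := ⟨fun _ => ⟨OrderIso.refl _⟩, fun ⟨f⟩ => ⟨f.symm⟩, fun ⟨f⟩ ⟨g⟩ => ⟨f.trans g⟩⟩

/-- Convex biembeddability on `LO`. -/
def cvxBiembLO : Setoid LO where
  r L M := CvxEmb (Dom L) (Dom M) ∧ CvxEmb (Dom M) (Dom L)
  iseqv :=
    { refl := fun L =>
        have h : CvxEmb (Dom L) (Dom L) :=
          ⟨RelEmbedding.refl _, ⟨fun _ _ _ _ z _ => ⟨z, rfl⟩⟩⟩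
        ⟨h, h⟩
      symm := fun h => ⟨h.2, h.1⟩
      trans := fun h h' => ⟨h.1.trans h'.1, h'.2.trans h.2⟩ }

/-- The set of (codes for) right compressible linear orders. -/
def LOr : Set LO := {L | RightCompressible (Dom L)}

/-- The set of (codes for) left compressible linear orders. -/
def LOl : Set LO := {L | LeftCompressible (Dom L)}

/-- The incompressible linear orders, those that are only left compressible, those that are only
right compressible, and the bicompressible ones. -/
def piece : Fin 4 → Set LO := ![(LOr ∪ LOl)ᶜ, LOl \ LOr, LOr \ LOl, LOr ∩ LOl]

/-- `φ` enumerates infinite suborders from the families `S L`: whenever `S L` has an infinite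
member, the terms of the sequence `φ L` are, up to isomorphism, exactly the infinite members of
`S L`. -/
def EnumeratesInfinite (S : (L : LO) → Set (Set (Dom L))) (φ : LO → ℕ → LO) : Prop :=
  ∀ L, (∃ s ∈ S L, s.Infinite) →
    (∀ k, ∃ s ∈ S L, s.Infinite ∧ Nonempty (Dom (φ L k) ≃o s)) ∧
    ∀ s ∈ S L, s.Infinite → ∃ k, Nonempty (Dom (φ L k) ≃o s)

/-- The closed intervals `[n, m]` of `L`. -/
def intervals (L : LO) : Set (Set (Dom L)) := {s | ∃ n m, s = Icc n m}

/-- The rays `[n, +∞)` of `L`. -/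
def upperRays (L : LO) : Set (Set (Dom L)) := {s | ∃ n, s = Ici n}

/-- The rays `(-∞, n]` of `L`. -/
def lowerRays (L : LO) : Set (Set (Dom L)) := {s | ∃ n, s = Iic n}

end CvxBiembed

open CvxBiembed

/-! Being compressible on one side means having a convex self-embedding whose range lies strictly
beyond some point (`leftCompressible_iff`, `rightCompressible_iff`). This form survives conjugation
by convex embeddings, so the four pieces are invariant. On the incompressible piece the composite of
the two embeddings must be onto, so biembeddable orders are isomorphic. A bicompressible order
embeds convexly into one of its own closed intervals, and convex embeddings carry closed intervals
to closed intervals. Hence the set of isomorphism types of infinite intervals is a complete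
invariant. For one-sided orders the embeddings are final or initial, and rays take over the role of
intervals. `exists_enumeratesInfinite` lists these suborders in a Borel way.

The jump of isomorphism is absorbed by a shuffle: sum the orders `1 + x n` along a countable dense
order in which every colour `n` is dense. Cantor's back-and-forth shows that the result depends only
on the set of types, and the coloured markers allow the summands to be recovered. Colours are then
removed by inflating each point to a rational block followed by a finite chain whose length encodes
the colour (`nonempty_blocks_orderIso_iff`).

The generic order is dense without endpoints, hence bicompressible, so one piece is comeagre and the
others are meagre. This gives the Baire property, and the reductions on the pieces are glued after
tagging each one with its own block length. Split graphs transfer everything to graph isomorphism.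
-/

namespace CvxBiembed

open Set Topology

/-! ### Compressibility and convex self-embeddings. -/

section Compressible

variable {α β : Type*} [LinearOrder α] [LinearOrder β]

/-- Pushing the elements below all iterates of a convex self-embedding one step up. -/
theorem leftCompressible_of_cvx (f : α ↪o α) (hf : (range f).OrdConnected) (z : α)
    (hz : ∀ y, z < f y) : LeftCompressible α := by
  classical
  -- `f` preserves both `A` and its complement, so it can be replaced by the identity off `A`; this
  -- makes the range an upper set.
  let A : Set α := {x | ∃ n : ℕ, ∀ y, x < f^[n] y}
  have hA : IsLowerSet A := fun x w hwx ⟨n, hn⟩ => ⟨n, fun y => hwx.trans_lt (hn y)⟩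
  have hfA : ∀ x, f x ∈ A ↔ x ∈ A := by
    refine fun x => ⟨fun ⟨n, hn⟩ => ⟨n, fun y => ?_⟩, fun ⟨n, hn⟩ => ⟨n + 1, fun y => ?_⟩⟩
    · have := hn (f y)
      rw [← Function.iterate_succ_apply, Function.iterate_succ_apply'] at this
      exact f.lt_iff_lt.1 this
    · rw [Function.iterate_succ_apply']
      exact f.lt_iff_lt.2 (hn y)
  have hlt : ∀ x w, x ∈ A → w ∉ A → x < w := fun x w hx hw =>
    lt_of_not_ge fun h => hw (hA h hx)
  let g : α → α := fun x => if x ∈ A then f x else x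
  have hg : StrictMono g := by
    intro x w hxw
    by_cases hw : w ∈ A
    · have hx : x ∈ A := hA hxw.le hw
      simpa [g, hx, hw] using hxw
    · by_cases hx : x ∈ A
      · simpa [g, hx, hw] using hlt _ _ ((hfA x).2 hx) hw
      · simpa [g, hx, hw] using hxw
  refine ⟨range g, ?_, ⟨z, ?_⟩, ⟨(hg.orderIso g).symm⟩⟩
  · rintro _ w hxw ⟨x, rfl⟩
    by_cases hw : w ∈ A
    · have hx : x ∈ A := by
        by_contra hx
        have : g x = x := if_neg hx
        exact hx (hA (this ▸ hxw) hw)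
      have hgx : g x = f x := if_pos hx
      rw [hgx] at hxw
      obtain ⟨n, hn⟩ := hw
      -- The exponent is positive, as exponent `0` would give `w < w`; hence `w` lies below a value
      -- of `f`, and convexity applies.
      have hn' : ∃ y, w ≤ f y := by
        cases n with
        | zero => exact absurd (hn w) (lt_irrefl _)
        | succ n => exact ⟨f^[n] w, by simpa [Function.iterate_succ_apply'] using (hn w).le⟩
      obtain ⟨y, hy⟩ := hn'
      obtain ⟨v, rfl⟩ := hf.out (mem_range_self x) (mem_range_self y) ⟨hxw, hy⟩
      have hv : v ∈ A := (hfA v).1 ⟨n, hn⟩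
      exact ⟨v, if_pos hv⟩
    · exact ⟨w, if_neg hw⟩
  · rintro ⟨x, hx⟩
    by_cases hxA : x ∈ A
    · have : g x = f x := if_pos hxA
      exact (hz x).ne (hx ▸ this)
    · have : g x = x := if_neg hxA
      exact hxA ⟨1, fun y => by rw [← this, hx]; exact hz y⟩

theorem leftCompressible_dual : LeftCompressible αᵒᵈ ↔ RightCompressible α := by
  constructor
  · rintro ⟨s, hs, hs', ⟨e⟩⟩
    exact ⟨OrderDual.toDual ⁻¹' s, fun a b h ha => hs (a := OrderDual.toDual a)
      (b := OrderDual.toDual b) h ha, hs', ⟨⟨e.toEquiv, fun {a b} => e.le_iff_le (x := b) (y := a)⟩⟩⟩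
  · rintro ⟨s, hs, hs', ⟨e⟩⟩
    exact ⟨OrderDual.ofDual ⁻¹' s, fun a b h ha => hs (a := OrderDual.ofDual a)
      (b := OrderDual.ofDual b) h ha, hs', ⟨⟨e.toEquiv, fun {a b} => e.le_iff_le (x := b) (y := a)⟩⟩⟩

/-- A bounded convex embedding can be composed with other convex embeddings, whereas a final copy
cannot directly; this form is what makes compressibility invariant. -/
theorem leftCompressible_iff : LeftCompressible α ↔
    ∃ f : α ↪o α, (range f).OrdConnected ∧ ∃ z, ∀ y, z < f y := by
  refine ⟨?_, fun ⟨f, hf, z, hz⟩ => leftCompressible_of_cvx f hf z hz⟩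
  rintro ⟨s, hs, ⟨z, hz⟩, ⟨e⟩⟩
  refine ⟨e.symm.toOrderEmbedding.trans (OrderEmbedding.subtype (· ∈ s)), ?_, z, fun y => ?_⟩
  · have : range (e.symm.toOrderEmbedding.trans (OrderEmbedding.subtype (· ∈ s))) = s := by
      ext x
      exact ⟨fun ⟨y, hy⟩ => hy ▸ (e.symm y).2, fun hx => ⟨e ⟨x, hx⟩, by simp⟩⟩
    rw [this]
    exact hs.ordConnected
  · exact lt_of_not_ge fun h => hz (hs h (e.symm y).2)

theorem rightCompressible_iff : RightCompressible α ↔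
    ∃ f : α ↪o α, (range f).OrdConnected ∧ ∃ z, ∀ y, f y < z := by
  rw [← leftCompressible_dual, leftCompressible_iff]
  constructor
  · rintro ⟨f, hf, z, hz⟩
    exact ⟨f.dual.trans (OrderIso.dualDual α).symm.toOrderEmbedding, ⟨fun a ha b hb x hx =>
      hf.out (x := b) (y := a) hb ha ⟨hx.2, hx.1⟩⟩, z, hz⟩
  · rintro ⟨f, hf, z, hz⟩
    exact ⟨f.dual, ⟨fun a ha b hb x hx => hf.out (x := b) (y := a) hb ha ⟨hx.2, hx.1⟩⟩, z, hz⟩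

theorem ordConnected_range_trans {γ : Type*} [LinearOrder γ] {f : α ↪o β} {g : β ↪o γ}
    (hf : (range f).OrdConnected) (hg : (range g).OrdConnected) :
    (range (f.trans g)).OrdConnected := by
  refine ⟨?_⟩
  rintro _ ⟨a, rfl⟩ _ ⟨b, rfl⟩ z hz
  obtain ⟨y, rfl⟩ := hg.out (mem_range_self (f a)) (mem_range_self (f b)) hz
  obtain ⟨x, rfl⟩ := hf.out (mem_range_self a) (mem_range_self b)
    ⟨g.le_iff_le.1 hz.1, g.le_iff_le.1 hz.2⟩
  exact ⟨x, rfl⟩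

theorem CvxEmb.of_orderIso (e : α ≃o β) : CvxEmb α β :=
  ⟨e.toOrderEmbedding, by
    have : range e.toOrderEmbedding = univ := e.surjective.range_eq
    rw [this]; exact ordConnected_univ⟩

theorem CvxEmb.subtype {s : Set α} (hs : s.OrdConnected) : CvxEmb s α :=
  ⟨OrderEmbedding.subtype (· ∈ s), by
    have : range (OrderEmbedding.subtype (· ∈ s)) = s := Subtype.range_coe
    rwa [this]⟩

theorem LeftCompressible.of_cvxEmb (h : LeftCompressible α) (h₁ : CvxEmb α β) (h₂ : CvxEmb β α) :
    LeftCompressible β := by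
  obtain ⟨e, he, z, hz⟩ := leftCompressible_iff.1 h
  obtain ⟨f, hf⟩ := h₁
  obtain ⟨g, hg⟩ := h₂
  exact leftCompressible_iff.2 ⟨(g.trans e).trans f,
    ordConnected_range_trans (ordConnected_range_trans hg he) hf, f z,
    fun y => f.lt_iff_lt.2 (hz _)⟩

theorem RightCompressible.of_cvxEmb (h : RightCompressible α) (h₁ : CvxEmb α β)
    (h₂ : CvxEmb β α) : RightCompressible β := by
  obtain ⟨e, he, z, hz⟩ := rightCompressible_iff.1 h
  obtain ⟨f, hf⟩ := h₁
  obtain ⟨g, hg⟩ := h₂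
  exact rightCompressible_iff.2 ⟨(g.trans e).trans f,
    ordConnected_range_trans (ordConnected_range_trans hg he) hf, f z,
    fun y => f.lt_iff_lt.2 (hz _)⟩

theorem forall_lt_or_forall_gt_of_notMem {f : α ↪o β} (hf : (range f).OrdConnected) {z : β}
    (hz : z ∉ range f) : (∀ y, z < f y) ∨ ∀ y, f y < z := by
  by_contra! h
  obtain ⟨⟨a, ha⟩, b, hb⟩ := h
  exact hz (hf.out (mem_range_self a) (mem_range_self b) ⟨ha, hb⟩)

/-- A point missed by `g` is missed by the convex self-embedding `g ∘ f`, hence bounds its range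
strictly on one side, and `α` would be compressible. -/
theorem CvxEmb.orderIso_of_incompressible (hl : ¬ LeftCompressible α) (hr : ¬ RightCompressible α)
    (h₁ : CvxEmb α β) (h₂ : CvxEmb β α) : Nonempty (α ≃o β) := by
  obtain ⟨f, hf⟩ := h₁
  obtain ⟨g, hg⟩ := h₂
  have hs : Function.Surjective g := by
    intro z
    by_contra hz
    have hz' : z ∉ range (f.trans g) := fun ⟨x, hx⟩ => hz ⟨f x, hx⟩
    have hfg := ordConnected_range_trans hf hg
    rcases forall_lt_or_forall_gt_of_notMem hfg hz' with h | h
    · exact hl (leftCompressible_iff.2 ⟨_, hfg, z, h⟩)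
    · exact hr (rightCompressible_iff.2 ⟨_, hfg, z, h⟩)
  exact ⟨(RelIso.ofSurjective g hs).symm⟩

/-- Over an order that is not right compressible, convex embeddings are final. -/
theorem isUpperSet_range_of_not_rightCompressible (hr : ¬ RightCompressible α)
    (f : α ↪o β) (hf : (range f).OrdConnected) (h₂ : CvxEmb β α) : IsUpperSet (range f) := by
  rintro _ z hxz ⟨x, rfl⟩
  by_contra hz
  obtain ⟨g, hg⟩ := h₂
  rcases forall_lt_or_forall_gt_of_notMem hf hz with h | h
  · exact (h x).not_ge hxz
  · exact hr (rightCompressible_iff.2 ⟨_, ordConnected_range_trans hf hg, g z,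
      fun y => g.lt_iff_lt.2 (h y)⟩)

/-- Over an order that is not left compressible, convex embeddings are initial. -/
theorem isLowerSet_range_of_not_leftCompressible (hl : ¬ LeftCompressible α)
    (f : α ↪o β) (hf : (range f).OrdConnected) (h₂ : CvxEmb β α) : IsLowerSet (range f) := by
  rintro _ z hxz ⟨x, rfl⟩
  by_contra hz
  obtain ⟨g, hg⟩ := h₂
  rcases forall_lt_or_forall_gt_of_notMem hf hz with h | h
  · exact hl (leftCompressible_iff.2 ⟨_, ordConnected_range_trans hf hg, g z,
      fun y => g.lt_iff_lt.2 (h y)⟩)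
  · exact (h x).not_ge hxz

/-- An order embedding restricts to an isomorphism of a set with its image. -/
theorem nonempty_orderIso_image (f : α ↪o β) (s : Set α) (t : Set β) (h : f '' s = t) :
    Nonempty (s ≃o t) := by
  subst h
  exact ⟨⟨Equiv.Set.image f s f.injective, fun {a b} => f.le_iff_le⟩⟩

theorem CvxEmb.of_range_subset {f : α ↪o β} (hf : (range f).OrdConnected) {s : Set β}
    (h : range f ⊆ s) : CvxEmb α s := by
  refine ⟨⟨⟨fun x => ⟨f x, h ⟨x, rfl⟩⟩, fun a b hab => f.injective (congrArg Subtype.val hab)⟩,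
    fun {a b} => f.le_iff_le⟩, ⟨?_⟩⟩
  rintro _ ⟨a, rfl⟩ _ ⟨b, rfl⟩ z hz
  obtain ⟨c, hc⟩ := hf.out (mem_range_self a) (mem_range_self b) (show z.1 ∈ Icc (f a) (f b) from hz)
  exact ⟨c, Subtype.ext hc⟩

theorem LeftCompressible.cvxEmb_Ici (h : LeftCompressible α) : ∃ n : α, CvxEmb α (Ici n) := by
  obtain ⟨f, hf, z, hz⟩ := leftCompressible_iff.1 h
  exact ⟨z, .of_range_subset hf (by rintro _ ⟨y, rfl⟩; exact (hz y).le)⟩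

theorem RightCompressible.cvxEmb_Iic (h : RightCompressible α) : ∃ n : α, CvxEmb α (Iic n) := by
  obtain ⟨f, hf, z, hz⟩ := rightCompressible_iff.1 h
  exact ⟨z, .of_range_subset hf (by rintro _ ⟨y, rfl⟩; exact (hz y).le)⟩

theorem LeftCompressible.cvxEmb_Icc (h : LeftCompressible α) (h' : RightCompressible α) :
    ∃ n m : α, CvxEmb α (Icc n m) := by
  obtain ⟨f, hf, z, hz⟩ := leftCompressible_iff.1 h
  obtain ⟨g, hg, w, hw⟩ := rightCompressible_iff.1 h'
  -- `f` is applied before `g`, so its lower bound `z` is moved to `g z`, while the bound `w` of `g`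
  -- stays.
  refine ⟨g z, w, .of_range_subset (ordConnected_range_trans hf hg) ?_⟩
  rintro _ ⟨y, rfl⟩
  exact ⟨g.le_iff_le.2 (hz y).le, (hw _).le⟩

end Compressible

/-! ### Borel coding of countable linear orders. -/

section Coding

theorem measurable_count {X : Type*} [MeasurableSpace X] {p : X → ℕ → Prop}
    [∀ x, DecidablePred (p x)] (hp : ∀ w, MeasurableSet {x | p x w}) (w : ℕ) :
    Measurable fun x => Nat.count (p x) w := by
  induction w with
  | zero => simp
  | succ w ih =>
    simp only [Nat.count_succ]
    exact ih.add (Measurable.ite (hp w) measurable_const measurable_const)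

/-- The `n`-th solution is `w` exactly when `w` is a solution with `n` solutions below it, and
counting is measurable. -/
theorem measurableSet_nth_eq {X : Type*} [MeasurableSpace X] {p : X → ℕ → Prop}
    (hp : ∀ w, MeasurableSet {x | p x w}) (hinf : ∀ x, {w | p x w}.Infinite) (n w : ℕ) :
    MeasurableSet {x | Nat.nth (p x) n = w} := by
  classical
  have : {x | Nat.nth (p x) n = w} = {x | p x w} ∩ {x | Nat.count (p x) w = n} := by
    ext x
    constructor
    · rintro rfl
      exact ⟨Nat.nth_mem_of_infinite (hinf x) n, Nat.count_nth_of_infinite (hinf x) n⟩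
    · rintro ⟨h, rfl⟩
      exact Nat.nth_count h
  rw [this]
  exact (hp w).inter (measurable_count hp w (measurableSet_singleton n))

theorem measurable_toLO {X : Type*} [MeasurableSpace X] {φ : X → LO}
    (h : ∀ n m, MeasurableSet {x | (φ x).1 (n, m) = true}) : Measurable φ := by
  refine Measurable.subtype_mk (measurable_pi_iff.2 fun p => ?_)
  exact measurable_to_bool (h p.1 p.2)

/-- The code of the order that `ℕ` carries when it is enumerated injectively in a linear order. -/
noncomputable def ofInjective {K : Type*} [LinearOrder K] (k : ℕ → K)
    (hk : Function.Injective k) : LO :=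
  ⟨fun p => decide (k p.1 ≤ k p.2), by simp, by simpa using fun n m l => le_trans,
    by simpa using fun n m h h' => hk (le_antisymm h h'), by simpa using fun n m => le_total _ _⟩

theorem ofInjective_apply {K : Type*} [LinearOrder K] (k : ℕ → K)
    (hk : Function.Injective k) (n m : ℕ) : (ofInjective k hk).1 (n, m) = true ↔ k n ≤ k m := by
  simp [ofInjective]

theorem nonempty_orderIso_ofInjective {K : Type*} [LinearOrder K] (k : ℕ → K)
    (hk : Function.Injective k) : Nonempty (Dom (ofInjective k hk) ≃o range k) :=
  ⟨⟨Equiv.ofInjective k hk, fun {a b} => (ofInjective_apply k hk a b).symm⟩⟩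

/-- Repetitions are discarded by keeping only the first index of each value; those indices form an
infinite measurable set, and listing them increasingly makes the enumeration injective. -/
theorem exists_code_of_nat {X : Type*} [MeasurableSpace X] {K : X → Type*}
    [∀ x, LinearOrder (K x)] (k : ∀ x, ℕ → K x) (hinf : ∀ x, (range (k x)).Infinite)
    (hm : ∀ v w, MeasurableSet {x | k x v ≤ k x w}) :
    ∃ φ : X → LO, Measurable φ ∧ ∀ x, Nonempty (Dom (φ x) ≃o range (k x)) := by
  let p : X → ℕ → Prop := fun x w => ∀ v < w, k x v ≠ k x w
  have hp : ∀ w, MeasurableSet {x | p x w} := by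
    intro w
    have : {x | p x w} = ⋂ v, ⋂ (_ : v < w), ({x | k x v ≤ k x w} ∩ {x | k x w ≤ k x v})ᶜ := by
      ext x
      simp [p, le_antisymm_iff]
    rw [this]
    exact .iInter fun v => .iInter fun _ => ((hm v w).inter (hm w v)).compl
  have hpr : ∀ x, k x '' {w | p x w} = range (k x) := by
    intro x
    refine (image_subset_range _ _).antisymm ?_
    rintro _ ⟨w, rfl⟩
    have h : ∃ v, k x v = k x w := ⟨w, rfl⟩
    classical
    exact ⟨Nat.find h, fun v hv hvk => Nat.find_min h hv (hvk.trans (Nat.find_spec h)),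
      Nat.find_spec h⟩
  have hpinf : ∀ x, {w | p x w}.Infinite := fun x h => hinf x (hpr x ▸ h.image _)
  have hinj : ∀ x, Function.Injective fun n => k x (Nat.nth (p x) n) := by
    intro x n m h
    have hn := Nat.nth_mem_of_infinite (hpinf x) n
    have hm := Nat.nth_mem_of_infinite (hpinf x) m
    rcases lt_trichotomy (Nat.nth (p x) n) (Nat.nth (p x) m) with h' | h' | h'
    · exact absurd h (hm _ h')
    · exact Nat.nth_injective (hpinf x) h'
    · exact absurd h.symm (hn _ h')
  refine ⟨fun x => ofInjective _ (hinj x), measurable_toLO fun n m => ?_, fun x => ?_⟩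
  · have : {x | (ofInjective _ (hinj x)).1 (n, m) = true} = ⋃ v, ⋃ w,
        {x | Nat.nth (p x) n = v} ∩ {x | Nat.nth (p x) m = w} ∩ {x | k x v ≤ k x w} := by
      ext x
      simp only [mem_ofPred_eq, ofInjective_apply, mem_iUnion, mem_inter_iff]
      exact ⟨fun h => ⟨_, _, ⟨rfl, rfl⟩, h⟩, by rintro ⟨_, _, ⟨rfl, rfl⟩, h⟩; exact h⟩
    rw [this]
    exact .iUnion fun v => .iUnion fun w => ((measurableSet_nth_eq hp hpinf n v).inter
      (measurableSet_nth_eq hp hpinf m w)).inter (hm v w)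
  · obtain ⟨e⟩ := nonempty_orderIso_ofInjective _ (hinj x)
    refine ⟨e.trans (OrderIso.setCongr _ _ ?_)⟩
    rw [← hpr x, ← Nat.range_nth_of_infinite (hpinf x), ← range_comp]
    rfl

/-- Linear orders that are presented in a measurable way on a countable set have codes that depend
measurably on the parameter. -/
theorem exists_code {X W : Type*} [MeasurableSpace X] [Countable W] {K : X → Type*}
    [∀ x, LinearOrder (K x)] (k : ∀ x, W → K x) (hinf : ∀ x, (range (k x)).Infinite)
    (hm : ∀ v w, MeasurableSet {x | k x v ≤ k x w}) :
    ∃ φ : X → LO, Measurable φ ∧ ∀ x, Nonempty (Dom (φ x) ≃o range (k x)) := by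
  rcases isEmpty_or_nonempty W with hW | hW
  · have : IsEmpty X := ⟨fun x => hinf x (by simp [range_eq_empty])⟩
    exact ⟨fun x => isEmptyElim x, measurable_of_empty _, fun x => isEmptyElim x⟩
  · obtain ⟨e, he⟩ := exists_surjective_nat W
    obtain ⟨φ, hφ, h⟩ := exists_code_of_nat (fun x n => k x (e n))
      (fun x => (he.range_comp (k x)).symm ▸ hinf x) fun v w => hm _ _
    refine ⟨φ, hφ, fun x => ?_⟩
    have := h x
    rwa [show (fun n => k x (e n)) = k x ∘ e from rfl, he.range_comp (k x)] at this

theorem exists_code_of_surjective {X W : Type*} [MeasurableSpace X] [Countable W]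
    {K : X → Type*} [∀ x, LinearOrder (K x)] [∀ x, Infinite (K x)] (k : ∀ x, W → K x)
    (hs : ∀ x, Function.Surjective (k x)) (hm : ∀ v w, MeasurableSet {x | k x v ≤ k x w}) :
    ∃ φ : X → LO, Measurable φ ∧ ∀ x, Nonempty (Dom (φ x) ≃o K x) := by
  obtain ⟨φ, hφ, h⟩ := exists_code k (fun x => by rw [(hs x).range_eq]; exact infinite_univ) hm
  refine ⟨φ, hφ, fun x => ?_⟩
  obtain ⟨e⟩ := h x
  rw [(hs x).range_eq] at e
  exact ⟨e.trans OrderIso.Set.univ⟩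

theorem exists_LO_orderIso (K : Type*) [LinearOrder K] [Countable K] [Infinite K] :
    ∃ L : LO, Nonempty (Dom L ≃o K) := by
  obtain ⟨φ, -, h⟩ := exists_code_of_surjective (X := Unit) (K := fun _ => K) (fun _ => id)
    (fun _ => Function.surjective_id) (by simp)
  exact ⟨φ (), h ()⟩

theorem measurableSet_dom_le (v w : ℕ) :
    MeasurableSet {L : LO | (show Dom L from v) ≤ (show Dom L from w)} := by
  have h : Measurable fun L : LO => L.1 (v, w) := (measurable_pi_apply _).comp measurable_subtype_coe
  exact h (measurableSet_singleton true)

instance (L : LO) : Infinite (Dom L) := inferInstanceAs (Infinite ℕ)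

instance (L : LO) : Countable (Dom L) := inferInstanceAs (Countable ℕ)

end Coding

/-! ### Borel enumeration of infinite suborders. -/

section Families

/-- Infinite subsets of the coded order that are given in a measurable way have codes that depend
measurably on the order. -/
theorem exists_code_subset (T : (L : LO) → Set (Dom L)) (hinf : ∀ L, (T L).Infinite)
    (hT : ∀ w : ℕ, MeasurableSet {L : LO | (show Dom L from w) ∈ T L}) :
    ∃ φ : LO → LO, Measurable φ ∧ ∀ L, Nonempty (Dom (φ L) ≃o T L) := by
  classical
  let p : LO → ℕ → Prop := fun L w => (show Dom L from w) ∈ T L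
  -- Non-members are redirected to the first member, so all of `ℕ` enumerates `T L` with
  -- repetitions.
  let idx : LO → ℕ → ℕ := fun L w => if p L w then w else Nat.nth (p L) 0
  have hidx : ∀ w u, MeasurableSet {L | idx L w = u} := by
    intro w u
    have : {L | idx L w = u} = ({L | p L w} ∩ {_L : LO | w = u}) ∪
        ({L | p L w}ᶜ ∩ {L | Nat.nth (p L) 0 = u}) := by
      ext L
      by_cases h : p L w <;> simp [idx, h]
    rw [this]
    exact ((hT w).inter (.const _)).union
      ((hT w).compl.inter (measurableSet_nth_eq hT hinf 0 u))
  have hrange : ∀ L, range (fun w => (show Dom L from idx L w)) = T L := by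
    intro L
    ext w
    constructor
    · rintro ⟨v, rfl⟩
      change (if p L v then v else Nat.nth (p L) 0 : ℕ) ∈ T L
      split_ifs with h
      · exact h
      · exact Nat.nth_mem_of_infinite (p := p L) (hinf L) 0
    · intro hw
      have h : p L w := hw
      exact ⟨w, by simp [idx, h]⟩
  obtain ⟨φ, hφ, h⟩ := exists_code (K := fun L : LO => Dom L)
    (fun L w => (show Dom L from idx L w)) (fun L => (hrange L).symm ▸ hinf L) fun v w => by
      have : {L | (show Dom L from idx L v) ≤ (show Dom L from idx L w)} = ⋃ a, ⋃ b,
          {L | idx L v = a} ∩ {L | idx L w = b} ∩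
            {L : LO | (show Dom L from a) ≤ (show Dom L from b)} := by
        ext L
        simp only [mem_ofPred_eq, mem_iUnion, mem_inter_iff]
        exact ⟨fun h => ⟨_, _, ⟨rfl, rfl⟩, h⟩, by rintro ⟨_, _, ⟨rfl, rfl⟩, h⟩; exact h⟩
      rw [this]
      exact .iUnion fun a => .iUnion fun b => ((hidx v a).inter (hidx w b)).inter
        (measurableSet_dom_le a b)
  refine ⟨φ, hφ, fun L => ?_⟩
  obtain ⟨e⟩ := h L
  exact ⟨e.trans (OrderIso.setCongr _ _ (hrange L))⟩

/-- A countable family of subsets of the coded order, given in a measurable way, has its infinite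
members enumerated by a measurable map. -/
theorem exists_enumeratesInfinite (S : (L : LO) → ℕ → Set (Dom L))
    (hS : ∀ k (w : ℕ), MeasurableSet {L : LO | (show Dom L from w) ∈ S L k}) :
    ∃ φ : LO → ℕ → LO, Measurable φ ∧ EnumeratesInfinite (fun L => range (S L)) φ := by
  classical
  have hinf : ∀ k, MeasurableSet {L : LO | (S L k).Infinite} := by
    intro k
    have : {L : LO | (S L k).Infinite} =
        ⋂ N : ℕ, ⋃ w : ℕ, ⋃ (_ : N < w), {L : LO | (show Dom L from w) ∈ S L k} := by
      ext L
      have := Set.infinite_iff_exists_gt (α := ℕ) (s := S L k)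
      simp only [mem_ofPred_eq, mem_iInter, mem_iUnion]
      refine this.trans (forall_congr' fun N => exists_congr fun w => ?_)
      exact ⟨fun h => ⟨h.2, h.1⟩, fun ⟨h, h'⟩ => ⟨h', h⟩⟩
    rw [this]
    exact .iInter fun N => .iUnion fun w => .iUnion fun _ => hS k w
  -- `good L k j`: the `k`-th term is a copy of the `j`-th set
  let good : LO → ℕ → ℕ → Prop := fun L k j =>
    (S L j).Infinite ∧ (j = k ∨ ¬ (S L k).Infinite ∧ ∀ i < j, ¬ (S L i).Infinite)
  have hgood : ∀ k j, MeasurableSet {L | good L k j} := by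
    intro k j
    have : {L | good L k j} = {L : LO | (S L j).Infinite} ∩ ({_L : LO | j = k} ∪
        ({L : LO | (S L k).Infinite}ᶜ ∩ ⋂ i, ⋂ (_ : i < j), {L : LO | (S L i).Infinite}ᶜ)) := by
      ext L
      simp [good]
    rw [this]
    exact (hinf j).inter ((MeasurableSet.const _).union ((hinf k).compl.inter
      (.iInter fun i => .iInter fun _ => (hinf i).compl)))
  -- At most one `j` is good. When none is, the condition is vacuous and `T k L` is the whole order,
  -- so that a code exists for every `L`.
  let T : (k : ℕ) → (L : LO) → Set (Dom L) := fun k L =>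
    {w | ∀ j, good L k j → w ∈ S L j}
  have hgood_unique : ∀ L k j j', good L k j → good L k j' → j = j' := by
    rintro L k j j' ⟨h, h₁ | ⟨h₁, h₂⟩⟩ ⟨h', h₁' | ⟨h₁', h₂'⟩⟩
    · rw [h₁, h₁']
    · exact absurd (h₁ ▸ h) h₁'
    · exact absurd (h₁' ▸ h') h₁
    · exact le_antisymm (not_lt.1 fun hlt => h₂ _ hlt h') (not_lt.1 fun hlt => h₂' _ hlt h)
  have hTgood : ∀ L k j, good L k j → T k L = S L j := by
    intro L k j hj
    ext w
    exact ⟨fun h => h j hj, fun h j' hj' => hgood_unique L k j j' hj hj' ▸ h⟩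
  have hTinf : ∀ k L, (T k L).Infinite := by
    intro k L
    by_cases h : ∃ j, good L k j
    · obtain ⟨j, hj⟩ := h
      rw [hTgood L k j hj]
      exact hj.1
    · have : T k L = univ := eq_univ_of_forall fun w j hj => absurd ⟨j, hj⟩ h
      rw [this]
      exact infinite_univ
  have hTm : ∀ k (w : ℕ), MeasurableSet {L : LO | (show Dom L from w) ∈ T k L} := by
    intro k w
    have : {L : LO | (show Dom L from w) ∈ T k L} =
        ⋂ j, ({L | good L k j}ᶜ ∪ {L : LO | (show Dom L from w) ∈ S L j}) := by
      ext L
      simp only [mem_ofPred_eq, mem_iInter, mem_union, mem_compl_iff, ← imp_iff_not_or]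
      rfl
    rw [this]
    exact .iInter fun j => (hgood k j).compl.union (hS j w)
  have key : ∀ k, ∃ φ : LO → LO, Measurable φ ∧ ∀ L, Nonempty (Dom (φ L) ≃o T k L) :=
    fun k => exists_code_subset (T k) (hTinf k) (hTm k)
  choose ψ hψ hψT using key
  refine ⟨fun L k => ψ k L, measurable_pi_iff.2 hψ, ?_⟩
  rintro L ⟨_, ⟨i, rfl⟩, hi⟩
  constructor
  · intro k
    have : ∃ j, good L k j := by
      by_cases hk : (S L k).Infinite
      · exact ⟨k, hk, .inl rfl⟩
      · have hex : ∃ i, (S L i).Infinite := ⟨i, hi⟩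
        exact ⟨Nat.find hex, Nat.find_spec hex, .inr ⟨hk, fun _ => Nat.find_min hex⟩⟩
    obtain ⟨j, hj⟩ := this
    exact ⟨_, ⟨j, rfl⟩, hj.1, hTgood L k j hj ▸ hψT k L⟩
  · rintro _ ⟨k, rfl⟩ hk
    exact ⟨k, hTgood L k k ⟨hk, .inl rfl⟩ ▸ hψT k L⟩

end Families

/-! ### Reductions to the jump on the compressible pieces. -/

section JumpOnPieces

theorem jump_isoLO_iff {x y : ℕ → LO} : jump isoLO x y ↔
    (∀ n, ∃ m, Nonempty (Dom (x n) ≃o Dom (y m))) ∧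
      ∀ n, ∃ m, Nonempty (Dom (y n) ≃o Dom (x m)) := by
  have h : ∀ u v : ℕ → LO, (range (fun n => Quotient.mk isoLO (u n)) ⊆
      range fun n => Quotient.mk isoLO (v n)) ↔
        ∀ n, ∃ m, Nonempty (Dom (u n) ≃o Dom (v m)) := by
    intro u v
    rw [range_subset_iff]
    refine forall_congr' fun n => exists_congr fun m => ?_
    rw [Quotient.eq]
    exact ⟨fun ⟨e⟩ => ⟨e.symm⟩, fun ⟨e⟩ => ⟨e.symm⟩⟩
  change range _ = range _ ↔ _
  rw [Subset.antisymm_iff, h, h]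

/-- A sequence enumerating the infinite members of a family of convex subsets determines the class
under convex biembeddability, when the order embeds in a member of the family and the family is
invariant under convex biembeddability. -/
theorem isBorelReductionOn_of_enumeratesInfinite {S : (L : LO) → Set (Set (Dom L))}
    {φ : LO → ℕ → LO} (hφ : Measurable φ) (hS : EnumeratesInfinite S φ) {A : Set LO}
    (hc : ∀ L, ∀ s ∈ S L, s.OrdConnected) (he : ∀ L ∈ A, ∃ s ∈ S L, CvxEmb (Dom L) s)
    (ht : ∀ L ∈ A, ∀ M ∈ A, cvxBiembLO L M → ∀ s ∈ S L, ∃ t ∈ S M, Nonempty (s ≃o t)) :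
    IsBorelReductionOn A cvxBiembLO (jump isoLO) φ := by
  have hex : ∀ L ∈ A, ∃ s ∈ S L, s.Infinite ∧ CvxEmb (Dom L) s := by
    intro L hL
    obtain ⟨s, hs, h⟩ := he L hL
    refine ⟨s, hs, ?_, h⟩
    obtain ⟨f, -⟩ := h
    exact infinite_coe_iff.1 (Infinite.of_injective f f.injective)
  have h₁ : ∀ L ∈ A, ∀ M ∈ A, cvxBiembLO L M → ∀ n, ∃ m,
      Nonempty (Dom (φ L n) ≃o Dom (φ M m)) := by
    intro L hL M hM h n
    obtain ⟨s, hs, hinf, -⟩ := hex L hL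
    obtain ⟨s', hs', hinf', ⟨e⟩⟩ := (hS L ⟨s, hs, hinf⟩).1 n
    obtain ⟨t, ht', ⟨e'⟩⟩ := ht L hL M hM h s' hs'
    have htinf : t.Infinite := by
      have := hinf'.to_subtype
      exact infinite_coe_iff.1 (Infinite.of_injective e' e'.injective)
    obtain ⟨m, ⟨e''⟩⟩ := (hS M ⟨t, ht', htinf⟩).2 t ht' htinf
    exact ⟨m, ⟨(e.trans e').trans e''.symm⟩⟩
  -- `L` embeds into a member of its own family; that member is listed by `φ L`, hence isomorphic to
  -- a term of `φ M`, which is a convex part of `M`.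
  have h₂ : ∀ L ∈ A, ∀ M ∈ A, (∀ n, ∃ m, Nonempty (Dom (φ L n) ≃o Dom (φ M m))) →
      CvxEmb (Dom L) (Dom M) := by
    intro L hL M hM h
    obtain ⟨s, hs, hinf, hLs⟩ := hex L hL
    obtain ⟨t, ht', hinf', -⟩ := hex M hM
    obtain ⟨n, ⟨e⟩⟩ := (hS L ⟨s, hs, hinf⟩).2 s hs hinf
    obtain ⟨m, ⟨e'⟩⟩ := h n
    obtain ⟨t', ht', -, ⟨e''⟩⟩ := (hS M ⟨t, ht', hinf'⟩).1 m
    exact hLs.trans ((CvxEmb.of_orderIso ((e.symm.trans e').trans e'')).trans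
      (CvxEmb.subtype (hc M t' ht')))
  refine ⟨hφ, fun L hL M hM => ?_⟩
  rw [jump_isoLO_iff]
  exact ⟨fun h => ⟨h₁ L hL M hM h, h₁ M hM L hL (cvxBiembLO.symm h)⟩,
    fun h => ⟨h₂ L hL M hM h.1, h₂ M hM L hL h.2⟩⟩

theorem image_Icc_of_ordConnected {α β : Type*} [LinearOrder α] [LinearOrder β] {f : α ↪o β}
    (hf : (range f).OrdConnected) (n m : α) : f '' Icc n m = Icc (f n) (f m) := by
  refine Subset.antisymm ?_ ?_
  · rintro _ ⟨x, hx, rfl⟩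
    exact ⟨f.le_iff_le.2 hx.1, f.le_iff_le.2 hx.2⟩
  · intro z hz
    obtain ⟨x, rfl⟩ := hf.out ⟨n, rfl⟩ ⟨m, rfl⟩ hz
    exact ⟨x, ⟨f.le_iff_le.1 hz.1, f.le_iff_le.1 hz.2⟩, rfl⟩

theorem image_Ici_of_isUpperSet {α β : Type*} [LinearOrder α] [LinearOrder β] {f : α ↪o β}
    (hf : IsUpperSet (range f)) (n : α) : f '' Ici n = Ici (f n) := by
  refine Subset.antisymm ?_ ?_
  · rintro _ ⟨x, hx, rfl⟩
    exact f.le_iff_le.2 hx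
  · intro z hz
    obtain ⟨x, rfl⟩ := hf hz ⟨n, rfl⟩
    exact ⟨x, f.le_iff_le.1 hz, rfl⟩

theorem image_Iic_of_isLowerSet {α β : Type*} [LinearOrder α] [LinearOrder β] {f : α ↪o β}
    (hf : IsLowerSet (range f)) (n : α) : f '' Iic n = Iic (f n) := by
  refine Subset.antisymm ?_ ?_
  · rintro _ ⟨x, hx, rfl⟩
    exact f.le_iff_le.2 hx
  · intro z hz
    obtain ⟨x, rfl⟩ := hf hz ⟨n, rfl⟩
    exact ⟨x, f.le_iff_le.1 hz, rfl⟩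

/-- Compressing on both sides embeds the order in one of its intervals, and any convex embedding
maps intervals onto intervals. -/
theorem exists_reduction_bicompressible : ∃ φ : LO → ℕ → LO, EnumeratesInfinite intervals φ ∧
    IsBorelReductionOn (LOr ∩ LOl) cvxBiembLO (jump isoLO) φ := by
  obtain ⟨φ, hφ, h⟩ := exists_enumeratesInfinite
    (fun L k => Icc (show Dom L from k.unpair.1) (show Dom L from k.unpair.2))
    fun k w => (measurableSet_dom_le _ _).inter (measurableSet_dom_le _ _)
  have hS : (fun L : LO => range fun k : ℕ =>
      Icc (show Dom L from k.unpair.1) (show Dom L from k.unpair.2)) = intervals := by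
    funext L
    ext s
    constructor
    · rintro ⟨k, rfl⟩
      exact ⟨_, _, rfl⟩
    · rintro ⟨n, m, rfl⟩
      refine ⟨Nat.pair n m, ?_⟩
      have h := Nat.unpair_pair n m
      dsimp only
      rw [h]
  rw [hS] at h
  refine ⟨φ, h, isBorelReductionOn_of_enumeratesInfinite hφ h ?_ ?_ ?_⟩
  · rintro L _ ⟨n, m, rfl⟩
    exact ordConnected_Icc
  · rintro L ⟨hr, hl⟩
    obtain ⟨n, m, hnm⟩ := LeftCompressible.cvxEmb_Icc (α := Dom L) hl hr
    exact ⟨_, ⟨n, m, rfl⟩, hnm⟩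
  · rintro L - M - ⟨⟨f, hf⟩, -⟩ _ ⟨n, m, rfl⟩
    exact ⟨_, ⟨f n, f m, rfl⟩, nonempty_orderIso_image f _ _ (image_Icc_of_ordConnected hf n m)⟩

/-- Failure of right compressibility makes the embeddings final, which is needed for upper rays to
go onto upper rays. -/
theorem exists_reduction_left_only : ∃ φ : LO → ℕ → LO, EnumeratesInfinite upperRays φ ∧
    IsBorelReductionOn (LOl \ LOr) cvxBiembLO (jump isoLO) φ := by
  obtain ⟨φ, hφ, h⟩ := exists_enumeratesInfinite (fun L k => Ici (show Dom L from k))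
    fun k w => measurableSet_dom_le _ _
  have hS : (fun L : LO => range fun k : ℕ => Ici (show Dom L from k)) = upperRays := by
    funext L
    ext s
    exact ⟨fun ⟨n, hn⟩ => ⟨n, hn.symm⟩, fun ⟨n, hn⟩ => ⟨n, hn.symm⟩⟩
  rw [hS] at h
  refine ⟨φ, h, isBorelReductionOn_of_enumeratesInfinite hφ h ?_ ?_ ?_⟩
  · rintro L _ ⟨n, rfl⟩
    exact ordConnected_Ici
  · rintro L ⟨hl, -⟩
    obtain ⟨n, hn⟩ := LeftCompressible.cvxEmb_Ici (α := Dom L) hl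
    exact ⟨_, ⟨n, rfl⟩, hn⟩
  · rintro L hL M - ⟨⟨f, hf⟩, h₂⟩ _ ⟨n, rfl⟩
    exact ⟨_, ⟨f n, rfl⟩, nonempty_orderIso_image f _ _
      (image_Ici_of_isUpperSet (isUpperSet_range_of_not_rightCompressible hL.2 f hf h₂) n)⟩

theorem exists_reduction_right_only : ∃ φ : LO → ℕ → LO, EnumeratesInfinite lowerRays φ ∧
    IsBorelReductionOn (LOr \ LOl) cvxBiembLO (jump isoLO) φ := by
  obtain ⟨φ, hφ, h⟩ := exists_enumeratesInfinite (fun L k => Iic (show Dom L from k))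
    fun k w => measurableSet_dom_le _ _
  have hS : (fun L : LO => range fun k : ℕ => Iic (show Dom L from k)) = lowerRays := by
    funext L
    ext s
    exact ⟨fun ⟨n, hn⟩ => ⟨n, hn.symm⟩, fun ⟨n, hn⟩ => ⟨n, hn.symm⟩⟩
  rw [hS] at h
  refine ⟨φ, h, isBorelReductionOn_of_enumeratesInfinite hφ h ?_ ?_ ?_⟩
  · rintro L _ ⟨n, rfl⟩
    exact ordConnected_Iic
  · rintro L ⟨hr, -⟩
    obtain ⟨n, hn⟩ := RightCompressible.cvxEmb_Iic (α := Dom L) hr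
    exact ⟨_, ⟨n, rfl⟩, hn⟩
  · rintro L hL M - ⟨⟨f, hf⟩, h₂⟩ _ ⟨n, rfl⟩
    exact ⟨_, ⟨f n, rfl⟩, nonempty_orderIso_image f _ _
      (image_Iic_of_isLowerSet (isLowerSet_range_of_not_leftCompressible hL.2 f hf h₂) n)⟩

end JumpOnPieces

/-! ### Invariance, disjointness and covering of the pieces. -/

section Incompressible

theorem closedUnder_LOr : ClosedUnder cvxBiembLO LOr :=
  fun _ hL _ h => RightCompressible.of_cvxEmb hL h.2 h.1

theorem closedUnder_LOl : ClosedUnder cvxBiembLO LOl :=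
  fun _ hL _ h => LeftCompressible.of_cvxEmb hL h.2 h.1

theorem ClosedUnder.compl {X : Type*} {E : Setoid X} {A : Set X} (h : ClosedUnder E A) :
    ClosedUnder E Aᶜ := fun _ hx _ hyx hy => hx (h _ hy _ (E.symm hyx))

theorem ClosedUnder.inter {X : Type*} {E : Setoid X} {A B : Set X} (h : ClosedUnder E A)
    (h' : ClosedUnder E B) : ClosedUnder E (A ∩ B) :=
  fun _ hx _ hyx => ⟨h _ hx.1 _ hyx, h' _ hx.2 _ hyx⟩

theorem closedUnder_piece (i : Fin 4) : ClosedUnder cvxBiembLO (piece i) := by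
  fin_cases i
  · change ClosedUnder _ (LOr ∪ LOl)ᶜ
    rw [compl_union]
    exact closedUnder_LOr.compl.inter closedUnder_LOl.compl
  · exact closedUnder_LOl.inter closedUnder_LOr.compl
  · exact closedUnder_LOr.inter closedUnder_LOl.compl
  · exact closedUnder_LOr.inter closedUnder_LOl

theorem cvxBiembLO_iff_isoLO_of_incompressible {L M : LO} (hL : L ∈ (LOr ∪ LOl)ᶜ) :
    cvxBiembLO L M ↔ isoLO L M := by
  constructor
  · rintro ⟨h₁, h₂⟩
    exact CvxEmb.orderIso_of_incompressible (fun h => hL (.inr h)) (fun h => hL (.inl h)) h₁ h₂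
  · rintro ⟨e⟩
    exact ⟨.of_orderIso e, .of_orderIso e.symm⟩

theorem pairwise_disjoint_piece : Pairwise fun i j => Disjoint (piece i) (piece j) := by
  intro i j hij
  rw [disjoint_left]
  intro L hi hj
  by_cases hr : L ∈ LOr <;> by_cases hl : L ∈ LOl <;>
    fin_cases i <;> fin_cases j <;> simp_all [piece]

theorem iUnion_piece : ⋃ i, piece i = univ := by
  refine eq_univ_of_forall fun L => mem_iUnion.2 ?_
  by_cases hr : L ∈ LOr <;> by_cases hl : L ∈ LOl
  · exact ⟨3, hr, hl⟩
  · exact ⟨2, hr, hl⟩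
  · exact ⟨1, hl, hr⟩
  · exact ⟨0, fun h => h.elim hr hl⟩

end Incompressible

/-! ### Removing colours from a linear order. -/

section Blocks

/-- The order `ℚ + (j + 2)`, realized inside `ℚ`. -/
def gadget (j : ℕ) : Set ℚ := {q | q < 0 ∨ ∃ i : ℕ, i ≤ j + 1 ∧ q = i}

theorem zero_mem_gadget (j : ℕ) : (0 : ℚ) ∈ gadget j := .inr ⟨0, by omega, by simp⟩

variable {P Q : Type*} [LinearOrder P] [LinearOrder Q]

/-- The order obtained from a coloured linear order by replacing a point of colour `j` by
`ℚ + (j + 2)`. -/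
def blocks (c : P → ℕ) : Set (P ×ₗ ℚ) := {t | (ofLex t).2 ∈ gadget (c (ofLex t).1)}

/-- The first point of the finite part of the block at `p`. -/
def blockHead (c : P → ℕ) (p : P) : blocks c := ⟨toLex (p, 0), zero_mem_gadget _⟩

theorem blockHead_le_iff {c : P → ℕ} {p p' : P} : blockHead c p ≤ blockHead c p' ↔ p ≤ p' := by
  change toLex (p, (0 : ℚ)) ≤ toLex (p', 0) ↔ _
  rw [Prod.Lex.toLex_le_toLex]
  simp [le_iff_lt_or_eq]

theorem blockHead_injective (c : P → ℕ) : Function.Injective (blockHead c) :=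
  fun _ _ h => le_antisymm (blockHead_le_iff.1 h.le) (blockHead_le_iff.1 h.ge)

theorem infinite_Icc_blocks {c : P → ℕ} {a b : blocks c} {p : P} {x y : ℚ} (hxy : x < y)
    (hy : y ≤ 0) (ha : ∀ q ∈ Ioo x y, a.1 ≤ toLex (p, q)) (hb : ∀ q ∈ Ioo x y, toLex (p, q) ≤ b.1) :
    (Icc a b).Infinite := by
  have hmem : ∀ q ∈ Ioo x y, toLex (p, q) ∈ blocks c := fun q hq => .inl (hq.2.trans_le hy)
  have := (Ioo_infinite hxy).to_subtype
  refine infinite_of_injective_forall_mem (f := fun q : Ioo x y =>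
    (⟨toLex (p, q.1), hmem q q.2⟩ : blocks c)) ?_ fun q => ⟨ha q q.2, hb q q.2⟩
  intro q q' h
  have h' : toLex (p, q.1) = toLex (p, q'.1) := congrArg Subtype.val h
  exact Subtype.ext (congrArg (fun t => (ofLex t).2) h')

/-- Unless both points lie in the finite part of one block, the interval contains a rational
interval: from the block of `b` if the blocks differ, and just above `a` otherwise. -/
theorem finite_Icc_blocks_iff {c : P → ℕ} {a b : blocks c} (hab : a < b) : (Icc a b).Finite ↔
    (ofLex a.1).1 = (ofLex b.1).1 ∧ 0 ≤ (ofLex a.1).2 := by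
  obtain ⟨a, ha⟩ := a
  obtain ⟨b, hb⟩ := b
  obtain ⟨⟨p, q⟩, rfl⟩ := toLex.surjective a
  obtain ⟨⟨p', q'⟩, rfl⟩ := toLex.surjective b
  have hab' : toLex (p, q) < toLex (p', q') := hab
  rw [Prod.Lex.toLex_lt_toLex] at hab'
  dsimp only [ofLex_toLex] at hab' ⊢
  constructor
  · intro h
    by_contra hn
    refine absurd h ?_
    rcases hab' with hp | ⟨rfl, hq⟩
    · refine infinite_Icc_blocks (p := p') (x := min q' 0 - 1) (y := min q' 0)
        (by linarith) (min_le_right _ _) (fun r hr => ?_) fun r hr => ?_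
      · exact Prod.Lex.toLex_le_toLex.2 (.inl hp)
      · exact Prod.Lex.toLex_le_toLex.2 (.inr ⟨rfl, (hr.2.trans_le (min_le_left _ _)).le⟩)
    · have hq0 : q < 0 := by
        by_contra h0
        exact hn ⟨rfl, not_lt.1 h0⟩
      refine infinite_Icc_blocks (p := p) (x := q) (y := min q' 0)
        (lt_min hq hq0) (min_le_right _ _) (fun r hr => ?_) fun r hr => ?_
      · exact Prod.Lex.toLex_le_toLex.2 (.inr ⟨rfl, hr.1.le⟩)
      · exact Prod.Lex.toLex_le_toLex.2 (.inr ⟨rfl, (hr.2.trans_le (min_le_left _ _)).le⟩)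
  · rintro ⟨rfl, hq⟩
    refine Finite.of_finite_image (f := Subtype.val) ?_ Subtype.val_injective.injOn
    refine ((finite_Iic (c p + 1)).image fun i : ℕ => toLex (p, (i : ℚ))).subset ?_
    rintro _ ⟨⟨t, ht⟩, ⟨h₁, h₂⟩, rfl⟩
    obtain ⟨⟨s, r⟩, rfl⟩ := toLex.surjective t
    have h₁' : toLex (p, q) ≤ toLex (s, r) := h₁
    have h₂' : toLex (s, r) ≤ toLex (p, q') := h₂
    rw [Prod.Lex.toLex_le_toLex] at h₁' h₂'
    dsimp only at h₁' h₂'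
    have hsp : s = p := by
      rcases h₁' with h | h
      · rcases h₂' with h' | h'
        · exact absurd h' h.not_gt
        · exact h'.1
      · exact h.1.symm
    subst hsp
    have hqr : q ≤ r := by simpa using h₁'
    rcases ht with h | ⟨i, hi, h⟩
    · exact absurd (hq.trans hqr) (not_le.2 h)
    · exact ⟨i, hi, congrArg (fun r => toLex (s, r)) (show r = i from h).symm⟩

/-- The points that start a maximal finite convex set with at least two elements. -/
def IsFiniteStart {α : Type*} [LinearOrder α] (t : α) : Prop :=
  (∀ s < t, (Icc s t).Infinite) ∧ ∃ u, t < u ∧ (Icc t u).Finite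

/-- The points above `t` at finite distance from it. -/
def finiteAbove {α : Type*} [LinearOrder α] (t : α) : Set α := {u | t ≤ u ∧ (Icc t u).Finite}

theorem finite_Icc_map_iff {α β : Type*} [LinearOrder α] [LinearOrder β] (e : α ≃o β) (a b : α) :
    (Icc (e a) (e b)).Finite ↔ (Icc a b).Finite := by
  rw [← e.image_Icc, finite_image_iff e.injective.injOn]

theorem IsFiniteStart.map {α β : Type*} [LinearOrder α] [LinearOrder β] (e : α ≃o β) {t : α}
    (h : IsFiniteStart t) : IsFiniteStart (e t) := by
  obtain ⟨h₁, u, hu, hu'⟩ := h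
  refine ⟨fun s hs => ?_, e u, e.lt_iff_lt.2 hu, (finite_Icc_map_iff e _ _).2 hu'⟩
  obtain ⟨s, rfl⟩ := e.surjective s
  exact fun h => h₁ s (e.lt_iff_lt.1 hs) ((finite_Icc_map_iff e _ _).1 h)

theorem ncard_finiteAbove_map {α β : Type*} [LinearOrder α] [LinearOrder β] (e : α ≃o β) (t : α) :
    (finiteAbove (e t)).ncard = (finiteAbove t).ncard := by
  rw [← ncard_image_of_injective _ e.injective]
  congr 1
  ext u
  obtain ⟨u, rfl⟩ := e.surjective u
  simp [finiteAbove, finite_Icc_map_iff]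

/-- A rational point has no finite interval above it, and a later point of the finite part has the
head at finite distance below. -/
theorem isFiniteStart_iff {c : P → ℕ} {t : blocks c} :
    IsFiniteStart t ↔ ∃ p, t = blockHead c p := by
  constructor
  · rintro ⟨h₁, u, hu, hu'⟩
    refine ⟨(ofLex t.1).1, ?_⟩
    have h0 := ((finite_Icc_blocks_iff hu).1 hu').2
    rcases h0.eq_or_lt with h | h
    · refine Subtype.ext ?_
      change toLex ((ofLex t.1).1, (ofLex t.1).2) = _
      rw [← h]
      rfl
    · have hlt : blockHead c (ofLex t.1).1 < t := by
        change toLex ((ofLex t.1).1, (0 : ℚ)) < toLex ((ofLex t.1).1, (ofLex t.1).2)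
        exact Prod.Lex.toLex_lt_toLex.2 (.inr ⟨rfl, h⟩)
      exact absurd ((finite_Icc_blocks_iff hlt).2 ⟨rfl, le_rfl⟩) (h₁ _ hlt)
  · rintro ⟨p, rfl⟩
    -- The point `1` is in every block because the finite part has at least two elements, even for
    -- colour `0`.
    refine ⟨fun s hs hf => ?_, ⟨⟨toLex (p, 1), .inr ⟨1, by omega, by simp⟩⟩, ?_, ?_⟩⟩
    · obtain ⟨h, h'⟩ := (finite_Icc_blocks_iff hs).1 hf
      have hs' : toLex ((ofLex s.1).1, (ofLex s.1).2) < toLex (p, (0 : ℚ)) := hs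
      rcases Prod.Lex.toLex_lt_toLex.1 hs' with h'' | h''
      · exact h''.ne h
      · exact absurd h''.2 (not_lt.2 h')
    · exact Prod.Lex.toLex_lt_toLex.2 (.inr ⟨rfl, zero_lt_one⟩)
    · refine (finite_Icc_blocks_iff ?_).2 ⟨rfl, le_rfl⟩
      exact Prod.Lex.toLex_lt_toLex.2 (.inr ⟨rfl, zero_lt_one⟩)

theorem ncard_finiteAbove_blockHead (c : P → ℕ) (p : P) :
    (finiteAbove (blockHead c p)).ncard = c p + 2 := by
  have : Subtype.val '' finiteAbove (blockHead c p) =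
      (fun i : ℕ => toLex (p, (i : ℚ))) '' (Finset.range (c p + 2) : Set ℕ) := by
    ext t
    obtain ⟨⟨s, r⟩, rfl⟩ := toLex.surjective t
    constructor
    · rintro ⟨u, ⟨hu, hu'⟩, hut⟩
      obtain ⟨t, ht⟩ := u
      subst hut
      rcases hu.eq_or_lt with h | h
      · refine ⟨0, by simp, ?_⟩
        have := congrArg Subtype.val h
        simpa [blockHead] using this
      · obtain ⟨h₁, -⟩ := (finite_Icc_blocks_iff h).1 hu'
        have h₁' : p = s := h₁
        subst h₁'
        have h₂ : toLex (p, (0 : ℚ)) < toLex (p, r) := h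
        rcases Prod.Lex.toLex_lt_toLex.1 h₂ with h₃ | h₃
        · exact absurd h₃ (lt_irrefl _)
        · rcases ht with h₄ | ⟨i, hi, h₄⟩
          · exact absurd h₃.2 (not_lt.2 (le_of_lt h₄))
          · have hi' : i ≤ c p + 1 := hi
            exact ⟨i, by simp; omega, congrArg (fun r => toLex (p, r)) (show r = i from h₄).symm⟩
    · rintro ⟨i, hi, h⟩
      have hi' : i < c p + 2 := by simpa using hi
      rw [← h]
      have hmem : toLex (p, (i : ℚ)) ∈ blocks c := .inr ⟨i, Nat.le_of_lt_succ hi', rfl⟩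
      refine ⟨⟨toLex (p, (i : ℚ)), hmem⟩, ?_, rfl⟩
      have hle : blockHead c p ≤ ⟨toLex (p, (i : ℚ)), hmem⟩ :=
        Prod.Lex.toLex_le_toLex.2 (.inr ⟨rfl, Nat.cast_nonneg i⟩)
      refine ⟨hle, ?_⟩
      rcases hle.eq_or_lt with h' | h'
      · rw [← h', Icc_self]
        exact finite_singleton _
      · exact (finite_Icc_blocks_iff h').2 ⟨rfl, le_rfl⟩
  rw [← ncard_image_of_injective _ Subtype.val_injective, this, ncard_image_of_injective,
    ncard_coe_finset, Finset.card_range]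
  intro i j hij
  exact Nat.cast_injective (R := ℚ) (congrArg (fun t : P ×ₗ ℚ => (ofLex t).2) hij)

theorem exists_map_blockHead {c : P → ℕ} {d : Q → ℕ} (F : blocks c ≃o blocks d) (p : P) :
    ∃ q, F (blockHead c p) = blockHead d q ∧ d q = c p := by
  obtain ⟨q, hq⟩ := isFiniteStart_iff.1 ((isFiniteStart_iff.2 ⟨p, rfl⟩).map F)
  refine ⟨q, hq, ?_⟩
  have := ncard_finiteAbove_map F (blockHead c p)
  rw [hq, ncard_finiteAbove_blockHead, ncard_finiteAbove_blockHead] at this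
  omega

/-- The coloured order can be recovered from the order of its blocks. -/
theorem nonempty_blocks_orderIso_iff {c : P → ℕ} {d : Q → ℕ} :
    Nonempty (blocks c ≃o blocks d) ↔ ∃ e : P ≃o Q, ∀ p, d (e p) = c p := by
  constructor
  · rintro ⟨F⟩
    -- Heads are characterized order-theoretically, and the number of points at finite distance
    -- above them reads off the colour.
    choose g hg hgc using exists_map_blockHead F
    choose g' hg' _ using exists_map_blockHead F.symm
    refine ⟨⟨⟨g, g', fun p => ?_, fun q => ?_⟩, fun {p p'} => ?_⟩, hgc⟩
    · exact blockHead_injective c (by rw [← hg', ← hg, F.symm_apply_apply])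
    · exact blockHead_injective d (by rw [← hg, ← hg', F.apply_symm_apply])
    · change g p ≤ g p' ↔ _
      rw [← blockHead_le_iff (c := d), ← hg, ← hg, F.le_iff_le, blockHead_le_iff]
  · rintro ⟨e, he⟩
    refine ⟨⟨⟨fun t => ⟨toLex (e (ofLex t.1).1, (ofLex t.1).2), ?_⟩,
      fun t => ⟨toLex (e.symm (ofLex t.1).1, (ofLex t.1).2), ?_⟩, fun t => ?_, fun t => ?_⟩, ?_⟩⟩
    · change (ofLex t.1).2 ∈ gadget (d (e (ofLex t.1).1))
      rw [he]
      exact t.2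
    · change (ofLex t.1).2 ∈ gadget (c (e.symm (ofLex t.1).1))
      rw [← he, e.apply_symm_apply]
      exact t.2
    · simp
    · simp
    · intro t t'
      change toLex (e (ofLex t.1).1, (ofLex t.1).2) ≤ toLex (e (ofLex t'.1).1, (ofLex t'.1).2) ↔
        t.1 ≤ t'.1
      rw [Prod.Lex.toLex_le_toLex, Prod.Lex.le_iff]
      simp

instance [Nonempty P] (c : P → ℕ) : Infinite (blocks c) := by
  obtain ⟨p⟩ := ‹Nonempty P›
  refine Infinite.of_injective (fun q : Iio (0 : ℚ) => (⟨toLex (p, q.1), .inl q.2⟩ : blocks c)) ?_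
  intro q q' h
  have h' : toLex (p, q.1) = toLex (p, q'.1) := congrArg Subtype.val h
  exact Subtype.ext (congrArg (fun t => (ofLex t).2) h')

theorem exists_code_blocks {X W : Type*} [MeasurableSpace X] [Countable W] {P : X → Type*}
    [∀ x, LinearOrder (P x)] [∀ x, Nonempty (P x)] (k : ∀ x, W → P x)
    (hs : ∀ x, Function.Surjective (k x)) (hm : ∀ v w, MeasurableSet {x | k x v ≤ k x w})
    (c : ∀ x, P x → ℕ) (hc : ∀ w j, MeasurableSet {x | c x (k x w) = j}) :
    ∃ φ : X → LO, Measurable φ ∧ ∀ x, Nonempty (Dom (φ x) ≃o blocks (c x)) := by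
  classical
  -- Rationals outside the gadget are sent to the head, so one index set `W × ℚ` enumerates the
  -- blocks for every parameter.
  let trunc : ℕ → ℚ → ℚ := fun j q => if q ∈ gadget j then q else 0
  have htrunc : ∀ j q, trunc j q ∈ gadget j := by
    intro j q
    simp only [trunc]
    split_ifs with h
    exacts [h, zero_mem_gadget j]
  refine exists_code_of_surjective (W := W × ℚ) (K := fun x => blocks (c x))
    (fun x w => ⟨toLex (k x w.1, trunc (c x (k x w.1)) w.2), htrunc _ _⟩) ?_ ?_
  · rintro x ⟨t, ht⟩
    obtain ⟨⟨p, q⟩, rfl⟩ := toLex.surjective t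
    obtain ⟨w, rfl⟩ := hs x p
    refine ⟨(w, q), Subtype.ext ?_⟩
    have : q ∈ gadget (c x (k x w)) := ht
    simp [trunc, this]
  · rintro ⟨v, q⟩ ⟨w, r⟩
    have : {x | (⟨toLex (k x v, trunc (c x (k x v)) q), htrunc _ _⟩ : blocks (c x)) ≤
        ⟨toLex (k x w, trunc (c x (k x w)) r), htrunc _ _⟩} = {x | k x w ≤ k x v}ᶜ ∪
        ({x | k x v ≤ k x w} ∩ {x | k x w ≤ k x v} ∩ ⋃ i, ⋃ j, {x | c x (k x v) = i} ∩
          {x | c x (k x w) = j} ∩ {_x | trunc i q ≤ trunc j r}) := by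
      ext x
      simp only [mem_ofPred_eq, mem_union, mem_compl_iff, mem_inter_iff, mem_iUnion, not_le,
        ← le_antisymm_iff]
      refine Prod.Lex.toLex_le_toLex.trans (or_congr_right (and_congr_right fun _ => ?_))
      exact ⟨fun h => ⟨_, _, ⟨rfl, rfl⟩, h⟩, by rintro ⟨_, _, ⟨rfl, rfl⟩, h⟩; exact h⟩
    rw [this]
    exact (hm _ _).compl.union (((hm _ _).inter (hm _ _)).inter (.iUnion fun i => .iUnion fun j =>
      ((hc _ _).inter (hc _ _)).inter (.const _)))

end Blocks

/-! ### Cantor's theorem for coloured orders. -/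

section BackAndForth

variable {α β C : Type*} [LinearOrder α] [LinearOrder β]

/-- Finite partial isomorphisms between two coloured linear orders. -/
def IsColoredPartialIso (c : α → C) (d : β → C) (f : Finset (α × β)) : Prop :=
  (∀ p ∈ f, ∀ q ∈ f, cmp p.1 q.1 = cmp p.2 q.2) ∧ ∀ p ∈ f, c p.1 = d p.2

theorem IsColoredPartialIso.swap [DecidableEq α] [DecidableEq β] {c : α → C} {d : β → C}
    {f : Finset (α × β)} (h : IsColoredPartialIso c d f) :
    IsColoredPartialIso d c (f.image Prod.swap) := by
  constructor
  · intro p hp q hq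
    obtain ⟨p', hp', rfl⟩ := Finset.mem_image.1 hp
    obtain ⟨q', hq', rfl⟩ := Finset.mem_image.1 hq
    exact (h.1 p' hp' q' hq').symm
  · intro p hp
    obtain ⟨p', hp', rfl⟩ := Finset.mem_image.1 hp
    exact (h.2 p' hp').symm

theorem IsColoredPartialIso.exists_insert [DecidableEq α] [DecidableEq β] [DenselyOrdered β]
    [NoMinOrder β] [NoMaxOrder β] [Nonempty β] {c : α → C} {d : β → C}
    (hd : ∀ a, ∀ x y : β, x < y → ∃ b, x < b ∧ b < y ∧ d b = c a)
    {f : Finset (α × β)} (h : IsColoredPartialIso c d f) (a : α) :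
    ∃ b, IsColoredPartialIso c d (insert (a, b) f) := by
  by_cases ha : ∃ b, (a, b) ∈ f
  · obtain ⟨b, hb⟩ := ha
    exact ⟨b, by rwa [Finset.insert_eq_of_mem hb]⟩
  let lo := {p ∈ f | p.1 < a}.image Prod.snd
  let hi := {p ∈ f | a < p.1}.image Prod.snd
  obtain ⟨x, hx, hx'⟩ := Order.exists_between_finsets lo hi (by
    intro u hu v hv
    obtain ⟨p, hp, rfl⟩ := Finset.mem_image.1 hu
    obtain ⟨q, hq, rfl⟩ := Finset.mem_image.1 hv
    rw [Finset.mem_filter] at hp hq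
    exact (lt_iff_lt_of_cmp_eq_cmp (h.1 p hp.1 q hq.1)).1 (hp.2.trans hq.2))
  -- A second point in the gap gives a nonempty open interval, in which the required colour is
  -- dense.
  obtain ⟨y, hy, hy'⟩ := Order.exists_between_finsets {x} hi (by
    intro u hu v hv
    rw [Finset.mem_singleton.1 hu]
    exact hx' v hv)
  obtain ⟨b, hxb, hby, hb⟩ := hd a x y (hy x (Finset.mem_singleton_self x))
  have key : ∀ p ∈ f, cmp p.1 a = cmp p.2 b := by
    intro p hp
    rcases lt_trichotomy p.1 a with hl | hl | hl
    · have h₂ : p.2 < b := (hx p.2 (Finset.mem_image.2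
        ⟨p, Finset.mem_filter.2 ⟨hp, hl⟩, rfl⟩)).trans hxb
      rw [(cmp_eq_lt_iff _ _).2 hl, (cmp_eq_lt_iff _ _).2 h₂]
    · exact absurd ⟨p.2, hl ▸ hp⟩ ha
    · have h₂ : b < p.2 := hby.trans (hy' p.2 (Finset.mem_image.2
        ⟨p, Finset.mem_filter.2 ⟨hp, hl⟩, rfl⟩))
      rw [(cmp_eq_gt_iff _ _).2 hl, (cmp_eq_gt_iff _ _).2 h₂]
  refine ⟨b, ?_, ?_⟩
  · intro p hp q hq
    rw [Finset.mem_insert] at hp hq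
    rcases hp with rfl | hp <;> rcases hq with rfl | hq
    · simp only [cmp_self_eq_eq]
    · rw [cmp_eq_cmp_symm]
      exact key q hq
    · exact key p hp
    · exact h.1 p hp q hq
  · intro p hp
    rw [Finset.mem_insert] at hp
    rcases hp with rfl | hp
    · exact hb.symm
    · exact h.2 p hp

/-- Cantor's theorem for coloured orders: two countable dense orders without endpoints, coloured so
that the colours occurring in either of them are dense in the other, are isomorphic. -/
theorem exists_orderIso_colored [Countable α] [DenselyOrdered α] [NoMinOrder α] [NoMaxOrder α]
    [Nonempty α] [Countable β] [DenselyOrdered β] [NoMinOrder β] [NoMaxOrder β] [Nonempty β]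
    (c : α → C) (d : β → C) (hc : ∀ b, ∀ x y : α, x < y → ∃ a, x < a ∧ a < y ∧ c a = d b)
    (hd : ∀ a, ∀ x y : β, x < y → ∃ b, x < b ∧ b < y ∧ d b = c a) :
    ∃ e : α ≃o β, ∀ a, d (e a) = c a := by
  classical
  cases nonempty_encodable α
  cases nonempty_encodable β
  let I := {f : Finset (α × β) // IsColoredPartialIso c d f}
  let left : α → Order.Cofinal I := fun a => ⟨{f | ∃ b, (a, b) ∈ f.1}, fun f => by
    obtain ⟨b, hb⟩ := f.2.exists_insert hd a
    exact ⟨⟨_, hb⟩, ⟨b, Finset.mem_insert_self _ _⟩, Finset.subset_insert _ _⟩⟩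
  let right : β → Order.Cofinal I := fun b => ⟨{f | ∃ a, (a, b) ∈ f.1}, fun f => by
    obtain ⟨a, ha⟩ := f.2.swap.exists_insert hc b
    refine ⟨⟨_, ha.swap⟩, ⟨a, ?_⟩, fun p hp => ?_⟩
    · exact Finset.mem_image.2 ⟨_, Finset.mem_insert_self _ _, rfl⟩
    · exact Finset.mem_image.2 ⟨p.swap, Finset.mem_insert_of_mem
        (Finset.mem_image_of_mem _ hp), rfl⟩⟩
  let 𝒟 : α ⊕ β → Order.Cofinal I := Sum.elim left right
  let J := Order.idealOfCofinals (⟨∅, by simp [IsColoredPartialIso]⟩ : I) 𝒟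
  have hF : ∀ a, ∃ b, ∃ f ∈ J, (a, b) ∈ f.1 := fun a => by
    obtain ⟨f, ⟨b, hb⟩, hf⟩ := Order.cofinal_meets_idealOfCofinals _ 𝒟 (.inl a)
    exact ⟨b, f, hf, hb⟩
  have hG : ∀ b, ∃ a, ∃ f ∈ J, (a, b) ∈ f.1 := fun b => by
    obtain ⟨f, ⟨a, ha⟩, hf⟩ := Order.cofinal_meets_idealOfCofinals _ 𝒟 (.inr b)
    exact ⟨a, f, hf, ha⟩
  choose F f hf hF using hF
  choose G g hg hG using hG
  refine ⟨OrderIso.ofCmpEqCmp F G fun a b => ?_, fun a => ((f a).2.2 _ (hF a)).symm⟩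
  -- Both pairs lie in a common partial isomorphism, which compares them consistently.
  obtain ⟨m, -, fm, gm⟩ := J.directed _ (hf a) _ (hg b)
  exact m.2.1 (a, _) (fm (hF a)) (_, b) (gm (hG b))

end BackAndForth

/-! ### A dense order with every colour dense. -/

section DenselyColored

/-- A countable dense linear order, coloured by the first coordinate. -/
def DenseIdx : Type := ℕ × ℚ

/-- The position of an element of `DenseIdx` on the real line. -/
noncomputable def DenseIdx.toReal (i : DenseIdx) : ℝ := (i.2 : ℝ) + (i.1 : ℝ) * √2

/-- A coincidence between different colours would make `√2` rational. -/
theorem DenseIdx.toReal_injective : Function.Injective DenseIdx.toReal := by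
  rintro ⟨n, q⟩ ⟨m, r⟩ h
  have h' : (q : ℝ) + n * √2 = r + m * √2 := h
  have hnm : n = m := by
    by_contra hne
    have hne' : ((n : ℝ) - m) ≠ 0 := sub_ne_zero.2 (by exact_mod_cast hne)
    refine irrational_sqrt_two.ne_rat ((r - q) / ((n : ℚ) - m)) ?_
    push_cast
    rw [eq_div_iff hne']
    linarith
  subst hnm
  have hqr : (q : ℝ) = r := by linarith
  exact Prod.ext rfl (by exact_mod_cast hqr)

noncomputable instance : LinearOrder DenseIdx :=
  LinearOrder.lift' DenseIdx.toReal DenseIdx.toReal_injective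

instance : Countable DenseIdx := inferInstanceAs (Countable (ℕ × ℚ))

instance : Nonempty DenseIdx := inferInstanceAs (Nonempty (ℕ × ℚ))

theorem DenseIdx.exists_mem_Ioo (n : ℕ) {x y : ℝ} (h : x < y) :
    ∃ i : DenseIdx, i.1 = n ∧ x < i.toReal ∧ i.toReal < y := by
  obtain ⟨q, hq, hq'⟩ := exists_rat_btwn (show x - n * √2 < y - n * √2 by linarith)
  refine ⟨(n, q), rfl, ?_, ?_⟩
  · change x < (q : ℝ) + n * √2
    linarith
  · change (q : ℝ) + n * √2 < y
    linarith

instance : DenselyOrdered DenseIdx := ⟨fun i j h => by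
  obtain ⟨k, -, h₁, h₂⟩ := DenseIdx.exists_mem_Ioo 0 (show i.toReal < j.toReal from h)
  exact ⟨k, h₁, h₂⟩⟩

instance : NoMinOrder DenseIdx := ⟨fun i => by
  obtain ⟨k, -, -, h₂⟩ := DenseIdx.exists_mem_Ioo 0 (sub_one_lt i.toReal)
  exact ⟨k, h₂⟩⟩

instance : NoMaxOrder DenseIdx := ⟨fun i => by
  obtain ⟨k, -, h₁, -⟩ := DenseIdx.exists_mem_Ioo 0 (lt_add_one i.toReal)
  exact ⟨k, h₁⟩⟩

end DenselyColored

/-! ### Reducing the jump of isomorphism to isomorphism. -/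

section Shuffle

variable {ι : Type*} [LinearOrder ι]

theorem sigmaLex_mk_le_mk {α : ι → Type*} [∀ i, LinearOrder (α i)] {i : ι} {a b : α i} :
    (toLex ⟨i, a⟩ : Σₗ i, α i) ≤ toLex ⟨i, b⟩ ↔ a ≤ b := by
  constructor
  · rintro (⟨_, _, h⟩ | ⟨_, _, h⟩)
    · exact absurd h (lt_irrefl _)
    · exact h
  · exact fun h => Sigma.Lex.right _ _ h

theorem sigmaLex_mk_lt_mk {α : ι → Type*} [∀ i, LinearOrder (α i)] {i : ι} {a b : α i} :
    (toLex ⟨i, a⟩ : Σₗ i, α i) < toLex ⟨i, b⟩ ↔ a < b := by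
  simp only [lt_iff_not_ge, sigmaLex_mk_le_mk]

theorem sigmaLex_lt_of_lt {α : ι → Type*} [∀ i, LinearOrder (α i)] {i j : ι} (h : i < j)
    (a : α i) (b : α j) : (toLex ⟨i, a⟩ : Σₗ i, α i) < toLex ⟨j, b⟩ := Sigma.Lex.left _ _ h

/-- The sum along `DenseIdx` of copies of `1 + x n`, where `n` is the colour of the index. -/
abbrev Shuffle (x : ℕ → LO) : Type := Σₗ i : DenseIdx, WithBot (Dom (x i.1))

/-- The colour `0` marks the first points of the summands. -/
noncomputable def shuffleColor (x : ℕ → LO) (t : Shuffle x) : ℕ :=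
  if (ofLex t).2 = ⊥ then 0 else 1

theorem shuffleColor_eq_zero {x : ℕ → LO} {i : DenseIdx} {a : WithBot (Dom (x i.1))} :
    shuffleColor x (toLex ⟨i, a⟩) = 0 ↔ a = ⊥ := by
  change (if a = ⊥ then 0 else 1) = 0 ↔ _
  split_ifs with h <;> simp [h]

/-- Colouring the indices by isomorphism classes, both sides show the same classes, each densely;
coloured Cantor matches the indices, and the summands are then matched one by one. -/
theorem exists_shuffle_iso_of_jump {x y : ℕ → LO} (h : jump isoLO x y) :
    ∃ e : Shuffle x ≃o Shuffle y, ∀ t, shuffleColor y (e t) = shuffleColor x t := by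
  have hdense : ∀ (u v : ℕ → LO), range (fun n => Quotient.mk isoLO (u n)) =
      range (fun n => Quotient.mk isoLO (v n)) → ∀ j : DenseIdx, ∀ a b : DenseIdx, a < b →
      ∃ i : DenseIdx, a < i ∧ i < b ∧ Quotient.mk isoLO (u i.1) = Quotient.mk isoLO (v j.1) := by
    intro u v huv j a b hab
    obtain ⟨n, hn⟩ := huv.ge (mem_range_self j.1)
    obtain ⟨i, rfl, h₁, h₂⟩ := DenseIdx.exists_mem_Ioo n (show a.toReal < b.toReal from hab)
    exact ⟨i, h₁, h₂, hn⟩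
  obtain ⟨g, hg⟩ := exists_orderIso_colored (fun i : DenseIdx => Quotient.mk isoLO (x i.1))
    (fun i : DenseIdx => Quotient.mk isoLO (y i.1)) (hdense x y h) (hdense y x h.symm)
  have hu : ∀ i : DenseIdx, Nonempty (Dom (x i.1) ≃o Dom (y (g i).1)) := fun i =>
    Quotient.exact (hg i).symm
  let u := fun i => (hu i).some
  let F : Shuffle x → Shuffle y := fun t =>
    toLex ⟨g (ofLex t).1, (u (ofLex t).1).withBotCongr (ofLex t).2⟩
  have hF : StrictMono F := by
    intro t t' htt'
    obtain ⟨⟨i, a⟩, rfl⟩ := toLex.surjective t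
    obtain ⟨⟨j, b⟩, rfl⟩ := toLex.surjective t'
    rcases lt_trichotomy i j with hij | rfl | hij
    · exact sigmaLex_lt_of_lt (g.lt_iff_lt.2 hij) _ _
    · exact sigmaLex_mk_lt_mk.2 ((u i).withBotCongr.lt_iff_lt.2 (sigmaLex_mk_lt_mk.1 htt'))
    · exact absurd htt' (sigmaLex_lt_of_lt hij _ _).not_gt
  have hFs : Function.Surjective F := by
    intro t
    obtain ⟨⟨j, b⟩, rfl⟩ := toLex.surjective t
    obtain ⟨i, rfl⟩ := g.surjective j
    obtain ⟨a, rfl⟩ := (u i).withBotCongr.surjective b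
    exact ⟨toLex ⟨i, a⟩, rfl⟩
  refine ⟨hF.orderIsoOfSurjective F hFs, fun t => ?_⟩
  obtain ⟨⟨i, a⟩, rfl⟩ := toLex.surjective t
  change shuffleColor y (toLex ⟨g i, (u i).withBotCongr a⟩) = _
  have : (u i).withBotCongr a = ⊥ ↔ a = ⊥ := by
    cases a <;> simp
  exact if_congr this rfl rfl

/-- A coloured isomorphism maps the summand after a marker into the summand after its image. -/
theorem exists_shuffle_map_coe {x y : ℕ → LO} (e : Shuffle x ≃o Shuffle y)
    (he : ∀ t, shuffleColor y (e t) = shuffleColor x t) {i j : DenseIdx}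
    (hij : e (toLex ⟨i, ⊥⟩) = toLex ⟨j, ⊥⟩) (a : Dom (x i.1)) :
    ∃ b : Dom (y j.1), e (toLex ⟨i, (a : WithBot _)⟩) = toLex ⟨j, (b : WithBot _)⟩ := by
  obtain ⟨⟨k, b⟩, hb⟩ := toLex.surjective (e (toLex ⟨i, (a : WithBot _)⟩))
  have hb_ne : b ≠ ⊥ := by
    intro h
    have := he (toLex ⟨i, (a : WithBot _)⟩)
    rw [← hb, shuffleColor_eq_zero.2 h] at this
    exact WithBot.coe_ne_bot (shuffleColor_eq_zero.1 this.symm)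
  have hlt : (toLex ⟨i, ⊥⟩ : Shuffle x) < toLex ⟨i, (a : WithBot _)⟩ :=
    sigmaLex_mk_lt_mk.2 (WithBot.bot_lt_coe a)
  have hlt' := e.lt_iff_lt.2 hlt
  rw [hij, ← hb] at hlt'
  have hkj : k = j := by
    rcases lt_trichotomy k j with h | h | h
    · exact absurd hlt' (sigmaLex_lt_of_lt h _ _).not_gt
    · exact h
    -- If the image lay in a later summand, that summand's marker would pull back to a marker
    -- strictly between two points of the `i`-th summand, whose only marker is its bottom.
    · exfalso
      have h₁ : (toLex ⟨j, ⊥⟩ : Shuffle y) < toLex ⟨k, ⊥⟩ := sigmaLex_lt_of_lt h _ _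
      have h₂ : (toLex ⟨k, ⊥⟩ : Shuffle y) < toLex ⟨k, b⟩ :=
        sigmaLex_mk_lt_mk.2 (bot_lt_iff_ne_bot.2 hb_ne)
      obtain ⟨t, ht⟩ := e.surjective (toLex ⟨k, ⊥⟩)
      rw [← ht, hb, e.lt_iff_lt] at h₂
      rw [← ht, ← hij, e.lt_iff_lt] at h₁
      have hc := he t
      rw [ht, shuffleColor_eq_zero.2 rfl] at hc
      obtain ⟨⟨l, s⟩, rfl⟩ := toLex.surjective t
      obtain rfl := shuffleColor_eq_zero.1 hc.symm
      rcases lt_trichotomy i l with h' | rfl | h'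
      · exact absurd h₂ (sigmaLex_lt_of_lt h' _ _).not_gt
      · exact lt_irrefl _ h₁
      · exact absurd h₁ (sigmaLex_lt_of_lt h' _ _).not_gt
  subst hkj
  obtain ⟨b, rfl⟩ := WithBot.ne_bot_iff_exists.1 hb_ne
  exact ⟨b, hb.symm⟩

theorem exists_orderIso_of_shuffle_iso {x y : ℕ → LO} (e : Shuffle x ≃o Shuffle y)
    (he : ∀ t, shuffleColor y (e t) = shuffleColor x t) (n : ℕ) :
    ∃ m, Nonempty (Dom (x n) ≃o Dom (y m)) := by
  -- Any index of colour `n` would do.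
  let i : DenseIdx := (n, 0)
  obtain ⟨⟨j, s⟩, hs⟩ := toLex.surjective (e (toLex ⟨i, ⊥⟩))
  have hc := he (toLex ⟨i, ⊥⟩)
  rw [← hs, shuffleColor_eq_zero.2 rfl] at hc
  obtain rfl := shuffleColor_eq_zero.1 hc
  have he' : ∀ t, shuffleColor x (e.symm t) = shuffleColor y t := fun t => by
    rw [← he, e.apply_symm_apply]
  have hs' : e.symm (toLex ⟨j, ⊥⟩) = toLex ⟨i, ⊥⟩ := by rw [hs, e.symm_apply_apply]
  choose f hf using exists_shuffle_map_coe e he hs.symm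
  choose g hg using exists_shuffle_map_coe e.symm he' hs'
  have hinj : ∀ (z : ℕ → LO) (k : DenseIdx) (a b : Dom (z k.1)),
      (toLex ⟨k, (a : WithBot _)⟩ : Shuffle z) = toLex ⟨k, (b : WithBot _)⟩ → a = b := by
    intro z k a b h
    have h₁ := sigmaLex_mk_le_mk.1 h.le
    have h₂ := sigmaLex_mk_le_mk.1 h.ge
    exact le_antisymm (WithBot.coe_le_coe.1 h₁) (WithBot.coe_le_coe.1 h₂)
  refine ⟨j.1, ⟨⟨⟨f, g, fun a => hinj x i _ _ ?_, fun b => hinj y j _ _ ?_⟩, fun {a b} => ?_⟩⟩⟩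
  · rw [← hg, ← hf, e.symm_apply_apply]
  · rw [← hf, ← hg, e.apply_symm_apply]
  · change f a ≤ f b ↔ a ≤ b
    rw [← WithBot.coe_le_coe, ← sigmaLex_mk_le_mk (α := fun i : DenseIdx => WithBot (Dom (y i.1))),
      ← hf, ← hf, e.le_iff_le, sigmaLex_mk_le_mk, WithBot.coe_le_coe]

theorem jump_isoLO_iff_shuffle {x y : ℕ → LO} : jump isoLO x y ↔
    ∃ e : Shuffle x ≃o Shuffle y, ∀ t, shuffleColor y (e t) = shuffleColor x t := by
  refine ⟨exists_shuffle_iso_of_jump, fun ⟨e, he⟩ => jump_isoLO_iff.2 ⟨?_, ?_⟩⟩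
  · exact exists_orderIso_of_shuffle_iso e he
  · exact exists_orderIso_of_shuffle_iso e.symm fun t => by rw [← he, e.apply_symm_apply]

/-- The coloured shuffle is a complete invariant for the jump; replacing its points by blocks turns
coloured isomorphism into plain isomorphism. -/
theorem borelReducible_jump_isoLO : BorelReducible (jump isoLO) isoLO := by
  let k : (x : ℕ → LO) → DenseIdx × Option ℕ → Shuffle x := fun x w =>
    toLex ⟨w.1, (show WithBot (Dom (x w.1.1)) from w.2)⟩
  have hk : ∀ i a b, {x | k x (i, a) ≤ k x (i, b)} =
      {x | (show WithBot (Dom (x i.1)) from a) ≤ (show WithBot (Dom (x i.1)) from b)} :=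
    fun i a b => Set.ext fun x => sigmaLex_mk_le_mk
  have hm : ∀ v w, MeasurableSet {x | k x v ≤ k x w} := by
    rintro ⟨i, a⟩ ⟨j, b⟩
    rcases lt_trichotomy i j with hij | rfl | hij
    · convert MeasurableSet.univ
      exact eq_univ_of_forall fun x => le_of_lt (show k x (i, a) < k x (j, b) from
        sigmaLex_lt_of_lt hij _ _)
    · rw [hk]
      rcases a with _ | a
      · convert MeasurableSet.univ
        exact eq_univ_of_forall fun x => bot_le (α := WithBot (Dom (x i.1)))
      · rcases b with _ | b
        · convert MeasurableSet.empty
          refine eq_empty_of_forall_notMem fun x => ?_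
          exact WithBot.not_coe_le_bot (α := Dom (x i.1)) a
        · have : {x : ℕ → LO | (show WithBot (Dom (x i.1)) from some a) ≤
              (show WithBot (Dom (x i.1)) from some b)} =
                {x | (show Dom (x i.1) from a) ≤ (show Dom (x i.1) from b)} :=
            Set.ext fun x => WithBot.coe_le_coe
          exact this ▸ measurable_pi_apply (X := fun _ => LO) i.1 (measurableSet_dom_le a b)
    · convert MeasurableSet.empty
      exact eq_empty_of_forall_notMem fun x => not_le_of_gt (show k x (j, b) < k x (i, a) from
        sigmaLex_lt_of_lt hij _ _)
  have hc : ∀ w j, MeasurableSet {x | shuffleColor x (k x w) = j} := by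
    rintro ⟨i, a⟩ j
    rcases a with _ | a
    · exact .const (0 = j)
    · exact .const (1 = j)
  obtain ⟨φ, hφ, h⟩ := exists_code_blocks k
    (fun x t => ⟨((ofLex t).1, (ofLex t).2), rfl⟩) hm shuffleColor hc
  refine ⟨φ, hφ, fun x y => ?_⟩
  obtain ⟨e⟩ := h x
  obtain ⟨e'⟩ := h y
  rw [jump_isoLO_iff_shuffle, ← nonempty_blocks_orderIso_iff]
  exact ⟨fun ⟨F⟩ => ⟨(e.trans F).trans e'.symm⟩, fun ⟨F⟩ => ⟨(e.symm.trans F).trans e'⟩⟩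

end Shuffle

/-! ### From linear orders to graphs. -/

section Graphs

variable {α β : Type*} [LinearOrder α] [LinearOrder β]

/-- Adjacency in the split graph of a linear order `α`: the vertices `inl a` form a clique, the
vertices `inr _` are independent, `inl a` is adjacent to `inr (inl b)` when `a ≤ b`, and to both of
the remaining vertices. -/
def splitAdj : α ⊕ (α ⊕ Bool) → α ⊕ (α ⊕ Bool) → Prop
  | .inl a, .inl b => a ≠ b
  | .inl a, .inr r => r.elim (a ≤ ·) fun _ => True
  | .inr r, .inl a => r.elim (a ≤ ·) fun _ => True
  | .inr _, .inr _ => False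

theorem splitAdj_symm : ∀ {u v : α ⊕ (α ⊕ Bool)}, splitAdj u v → splitAdj v u
  | .inl _, .inl _, h => Ne.symm h
  | .inl _, .inr _, h => h
  | .inr _, .inl _, h => h

theorem splitAdj_irrefl : ∀ u : α ⊕ (α ⊕ Bool), ¬ splitAdj u u
  | .inl _, h => h rfl

variable (α) in
/-- The split graph of a linear order. -/
def splitGraph : SimpleGraph (α ⊕ (α ⊕ Bool)) where
  Adj := splitAdj
  symm := ⟨fun _ _ => splitAdj_symm⟩
  loopless := ⟨splitAdj_irrefl⟩

/-- The neighbours of `v` form a clique. -/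
def IsSimplicial {V : Type*} (G : SimpleGraph V) (v : V) : Prop :=
  ∀ y z, G.Adj v y → G.Adj v z → y ≠ z → G.Adj y z

/-- The two extra vertices are non-adjacent common neighbours of every clique vertex; this is their
only purpose. -/
theorem isSimplicial_splitGraph_iff {v : α ⊕ (α ⊕ Bool)} :
    IsSimplicial (splitGraph α) v ↔ ∃ r, v = .inr r := by
  constructor
  · intro h
    rcases v with a | r
    · exact (h (.inr (.inr false)) (.inr (.inr true)) trivial trivial (by simp)).elim
    · exact ⟨r, rfl⟩
  · rintro ⟨r, rfl⟩ (y | y) (z | z) hy hz hyz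
    · exact fun h => hyz (congrArg _ h)
    · exact False.elim hz
    · exact False.elim hy
    · exact False.elim hy

theorem isSimplicial_map_iff {V V' : Type*} {G : SimpleGraph V} {G' : SimpleGraph V'}
    (F : G ≃g G') (v : V) : IsSimplicial G' (F v) ↔ IsSimplicial G v := by
  simp only [IsSimplicial, F.surjective.forall, F.map_adj_iff, F.injective.ne_iff]

/-- Up to the extra vertices, the independent neighbours of a clique vertex form its upper ray, so
the order is reverse inclusion, expressed in pure graph terms. -/
theorem le_iff_splitGraph {a b : α} : a ≤ b ↔ ∀ y, IsSimplicial (splitGraph α) y →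
    (splitGraph α).Adj (.inl b) y → (splitGraph α).Adj (.inl a) y := by
  constructor
  · rintro h y hy hb
    obtain ⟨c | c, rfl⟩ := isSimplicial_splitGraph_iff.1 hy
    · exact h.trans hb
    · trivial
  · intro h
    exact h (.inr (.inl b)) (isSimplicial_splitGraph_iff.2 ⟨_, rfl⟩) le_rfl

theorem exists_splitGraph_map_inl (F : splitGraph α ≃g splitGraph β) (a : α) :
    ∃ b : β, F (.inl a) = .inl b := by
  rcases h : F (.inl a) with b | r
  · exact ⟨b, rfl⟩
  · have h₁ := isSimplicial_splitGraph_iff.2 ⟨r, h⟩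
    rw [isSimplicial_map_iff, isSimplicial_splitGraph_iff] at h₁
    obtain ⟨r', h'⟩ := h₁
    cases h'

theorem nonempty_splitGraph_iso_iff :
    Nonempty (splitGraph α ≃g splitGraph β) ↔ Nonempty (α ≃o β) := by
  constructor
  · rintro ⟨F⟩
    choose f hf using exists_splitGraph_map_inl F
    choose g hg using exists_splitGraph_map_inl F.symm
    refine ⟨⟨⟨f, g, fun a => Sum.inl_injective (β := α ⊕ Bool) ?_,
      fun b => Sum.inl_injective (β := β ⊕ Bool) ?_⟩, fun {a b} => ?_⟩⟩
    · exact (hg (f a)).symm.trans (by rw [← hf, RelIso.symm_apply_apply])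
    · exact (hf (g b)).symm.trans (by rw [← hg, RelIso.apply_symm_apply])
    · change f a ≤ f b ↔ a ≤ b
      rw [le_iff_splitGraph, le_iff_splitGraph, ← hf, ← hf, F.surjective.forall]
      simp only [isSimplicial_map_iff, F.map_adj_iff]
  · rintro ⟨e⟩
    refine ⟨⟨Equiv.sumCongr e.toEquiv (Equiv.sumCongr e.toEquiv (Equiv.refl _)), ?_⟩⟩
    rintro (a | a | a) (b | b | b)
    · exact e.injective.ne_iff
    · exact e.le_iff_le
    · exact Iff.rfl
    · exact e.le_iff_le
    · exact Iff.rfl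
    · exact Iff.rfl
    · exact Iff.rfl
    · exact Iff.rfl
    · exact Iff.rfl

/-- An enumeration of the vertices of split graphs of orders on `ℕ`. -/
noncomputable def vertexEquiv : ℕ ≃ ℕ ⊕ (ℕ ⊕ Bool) := nonempty_equiv_of_countable.some

/-- An enumeration of the vertices of the split graph of an order on `ℕ`. -/
noncomputable def splitEquiv (L : LO) : ℕ ≃ Dom L ⊕ (Dom L ⊕ Bool) :=
  vertexEquiv

open Classical in
/-- The code of the split graph of a linear order. -/
noncomputable def splitCode (L : LO) : GRAPH :=
  ⟨fun p => decide ((splitGraph (Dom L)).Adj (splitEquiv L p.1) (splitEquiv L p.2)),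
    by simp, by simpa using fun n m h => h.symm⟩

theorem nonempty_splitCode_iso (L : LO) : Nonempty (toGraph (splitCode L) ≃g splitGraph (Dom L)) :=
  ⟨⟨splitEquiv L, by simp [toGraph, splitCode]⟩⟩

theorem measurable_splitCode : Measurable splitCode := by
  refine Measurable.subtype_mk (measurable_pi_iff.2 fun p => measurable_to_bool ?_)
  classical
  have : (fun L : LO => decide ((splitGraph (Dom L)).Adj (splitEquiv L p.1) (splitEquiv L p.2))) ⁻¹'
      {true} = {L : LO | splitAdj (splitEquiv L p.1) (splitEquiv L p.2)} := by
    ext L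
    simp only [mem_preimage, mem_singleton_iff, decide_eq_true_eq]
    rfl
  rw [this]
  have key : ∀ u v : ℕ ⊕ (ℕ ⊕ Bool), MeasurableSet {L : LO | splitAdj
      (show Dom L ⊕ (Dom L ⊕ Bool) from u) (show Dom L ⊕ (Dom L ⊕ Bool) from v)} := by
    rintro (a | a | a) (b | b | b)
    · exact .const (a ≠ b)
    · exact measurableSet_dom_le a b
    · exact .const True
    · exact measurableSet_dom_le b a
    · exact .const False
    · exact .const False
    · exact .const True
    · exact .const False
    · exact .const False
  exact key (vertexEquiv p.1) (vertexEquiv p.2)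

theorem borelReducible_isoLO_isoGRAPH : BorelReducible isoLO isoGRAPH := by
  refine ⟨splitCode, measurable_splitCode, fun L M => ?_⟩
  obtain ⟨F⟩ := nonempty_splitCode_iso L
  obtain ⟨G⟩ := nonempty_splitCode_iso M
  change Nonempty _ ↔ Nonempty _
  rw [← nonempty_splitGraph_iso_iff]
  exact ⟨fun ⟨H⟩ => ⟨(F.trans H).trans G.symm⟩, fun ⟨H⟩ => ⟨(F.symm.trans H).trans G⟩⟩

end Graphs

/-! ### The generic linear order. -/

section Generic

/-- The number `n` as a point of the order coded by `L`. -/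
def pt (L : LO) (n : ℕ) : Dom L := n

theorem isOpen_dom_lt (v w : ℕ) :
    IsOpen {L : LO | pt L v < pt L w} := by
  have h : Continuous fun L : LO => L.1 (w, v) := (continuous_apply _).comp continuous_subtype_val
  have : {L : LO | pt L v < pt L w} =
      (fun L : LO => L.1 (w, v)) ⁻¹' {true}ᶜ := by
    ext L
    exact lt_iff_not_ge (a := pt L v) (b := pt L w)
  rw [this]
  exact (isOpen_discrete _).preimage h

/-- A basic neighbourhood constrains finitely many pairs, all below some `N`. -/
theorem dense_LO_of_exists {S : Set LO}
    (h : ∀ (L : LO) (N : ℕ), ∃ M : LO, M ∈ S ∧ ∀ n < N, ∀ m < N, M.1 (n, m) = L.1 (n, m)) : Dense S := by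
  intro L
  rw [mem_closure_iff]
  rintro o ho hL
  obtain ⟨o', ho', rfl⟩ := isOpen_induced_iff.1 ho
  obtain ⟨I, u, hu, hsub⟩ := isOpen_pi_iff.1 ho' L.1 hL
  obtain ⟨N, hN⟩ : ∃ N, ∀ p ∈ I, p.1 < N ∧ p.2 < N := by
    refine ⟨I.sup (fun p => max p.1 p.2) + 1, fun p hp => ?_⟩
    have := Finset.le_sup (f := fun p : ℕ × ℕ => max p.1 p.2) hp
    exact ⟨by omega, by omega⟩
  obtain ⟨M, hM, hML⟩ := h L N
  refine ⟨M, hsub fun p hp => ?_, hM⟩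
  have := hML p.1 (hN p hp).1 p.2 (hN p hp).2
  rw [show M.1 p = L.1 p from this]
  exact (hu p hp).2

/-- Insert the numbers `≥ N` in `L` immediately above (for positive `s`) or below (for negative `s`)
the point `n`. -/
theorem exists_insertion (L : LO) (N n : ℕ) (s : ℤ) (hs : s ≠ 0) :
    ∃ (M : LO) (k : ℕ → Dom L ×ₗ ℤ), (∀ w < N, k w = toLex (pt L w, 0)) ∧
      (∀ w, N ≤ w → k w = toLex (pt L n, s * (w + 1))) ∧
      (∀ v w : ℕ, pt M v < pt M w ↔ k v < k w) ∧
      ∀ v < N, ∀ w < N, M.1 (v, w) = L.1 (v, w) := by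
  -- The shift `w + 1` keeps the offset nonzero, so new points never meet the old ones at offset
  -- `0`.
  let k : ℕ → Dom L ×ₗ ℤ := fun w => if w < N then toLex (pt L w, 0) else toLex (pt L n, s * (w + 1))
  have hk₁ : ∀ w < N, k w = toLex (pt L w, 0) := fun w hw => if_pos hw
  have hk₂ : ∀ w, N ≤ w → k w = toLex (pt L n, s * (w + 1)) := fun w hw => if_neg (not_lt.2 hw)
  have hne : ∀ w : ℕ, s * (w + 1 : ℤ) ≠ 0 := fun w => mul_ne_zero hs (by omega)
  have hinj : Function.Injective k := by
    intro v w h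
    rcases lt_or_ge v N with hv | hv <;> rcases lt_or_ge w N with hw | hw
    · rw [hk₁ v hv, hk₁ w hw] at h
      exact congrArg (fun t : Dom L ×ₗ ℤ => (ofLex t).1) h
    · rw [hk₁ v hv, hk₂ w hw] at h
      exact absurd (congrArg (fun t : Dom L ×ₗ ℤ => (ofLex t).2) h).symm (hne w)
    · rw [hk₂ v hv, hk₁ w hw] at h
      exact absurd (congrArg (fun t : Dom L ×ₗ ℤ => (ofLex t).2) h) (hne v)
    · rw [hk₂ v hv, hk₂ w hw] at h
      have h' : s * (v + 1 : ℤ) = s * (w + 1) := congrArg (fun t : Dom L ×ₗ ℤ => (ofLex t).2) h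
      have := mul_left_cancel₀ hs h'
      omega
  refine ⟨ofInjective k hinj, k, hk₁, hk₂, fun v w => ?_, fun v hv w hw => ?_⟩
  · rw [lt_iff_not_ge, lt_iff_not_ge]
    exact (ofInjective_apply k hinj w v).not
  · rw [Bool.eq_iff_iff, ofInjective_apply, hk₁ v hv, hk₁ w hw, Prod.Lex.toLex_le_toLex]
    change pt L v < pt L w ∨ pt L v = pt L w ∧
      (0 : ℤ) ≤ 0 ↔ pt L v ≤ pt L w
    simp [le_iff_lt_or_eq]

theorem mem_residual_exists_gt (n : ℕ) :
    {L : LO | ∃ m : ℕ, pt L n < pt L m} ∈ residual LO := by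
  refine residual_of_dense_open ?_ (dense_LO_of_exists fun L N => ?_)
  · convert isOpen_iUnion fun m => isOpen_dom_lt n m using 1
    ext L
    simp
  · obtain ⟨M, k, hk₁, hk₂, hM, hML⟩ := exists_insertion L (max N (n + 1)) n 1 one_ne_zero
    refine ⟨M, ⟨max N (n + 1), (hM _ _).2 ?_⟩, fun v hv w hw =>
      hML v (lt_max_of_lt_left hv) w (lt_max_of_lt_left hw)⟩
    rw [hk₁ n (by omega), hk₂ _ le_rfl]
    exact Prod.Lex.toLex_lt_toLex.2 (.inr ⟨rfl, by dsimp only; omega⟩)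

theorem mem_residual_exists_lt (n : ℕ) :
    {L : LO | ∃ m : ℕ, pt L m < pt L n} ∈ residual LO := by
  refine residual_of_dense_open ?_ (dense_LO_of_exists fun L N => ?_)
  · convert isOpen_iUnion fun m => isOpen_dom_lt m n using 1
    ext L
    simp
  · obtain ⟨M, k, hk₁, hk₂, hM, hML⟩ := exists_insertion L (max N (n + 1)) n (-1) (by decide)
    refine ⟨M, ⟨max N (n + 1), (hM _ _).2 ?_⟩, fun v hv w hw =>
      hML v (lt_max_of_lt_left hv) w (lt_max_of_lt_left hw)⟩
    rw [hk₁ n (by omega), hk₂ _ le_rfl]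
    exact Prod.Lex.toLex_lt_toLex.2 (.inr ⟨rfl, by dsimp only; omega⟩)

/-- Density at the pair `n`, `m` is phrased as a disjunction so that the set is visibly open. -/
theorem mem_residual_exists_between (n m : ℕ) :
    {L : LO | pt L m < pt L n ∨ n = m ∨ ∃ k : ℕ,
      pt L n < pt L k ∧ pt L k < pt L m} ∈
      residual LO := by
  refine residual_of_dense_open ?_ (dense_LO_of_exists fun L N => ?_)
  · have h := (isOpen_dom_lt m n).union ((isOpen_const (X := LO) (p := n = m)).union
      (isOpen_iUnion fun k => (isOpen_dom_lt n k).inter (isOpen_dom_lt k m)))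
    convert h using 1
    ext L
    simp
  · obtain ⟨M, k, hk₁, hk₂, hM, hML⟩ := exists_insertion L (max N (max n m + 1)) n 1 one_ne_zero
    refine ⟨M, ?_, fun v hv w hw => hML v (lt_max_of_lt_left hv) w (lt_max_of_lt_left hw)⟩
    have hn := hk₁ n (by omega)
    have hm := hk₁ m (by omega)
    rcases lt_trichotomy (pt L n) (pt L m) with h | h | h
    · refine .inr (.inr ⟨max N (max n m + 1), (hM _ _).2 ?_, (hM _ _).2 ?_⟩)
      · rw [hn, hk₂ _ le_rfl]
        exact Prod.Lex.toLex_lt_toLex.2 (.inr ⟨rfl, by dsimp only; omega⟩)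
      · rw [hm, hk₂ _ le_rfl]
        exact Prod.Lex.toLex_lt_toLex.2 (.inl h)
    · exact .inr (.inl h)
    · refine .inl ((hM _ _).2 ?_)
      rw [hn, hm]
      exact Prod.Lex.toLex_lt_toLex.2 (.inl h)

theorem bicompressible_of_dense {α : Type*} [LinearOrder α] [Countable α] [DenselyOrdered α]
    [NoMinOrder α] [NoMaxOrder α] [Nonempty α] : RightCompressible α ∧ LeftCompressible α := by
  obtain ⟨a⟩ := ‹Nonempty α›
  obtain ⟨b, hb⟩ := exists_lt a
  obtain ⟨c, hc⟩ := exists_gt a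
  have : Nonempty (Iio a) := ⟨⟨b, hb⟩⟩
  have : Nonempty (Ioi a) := ⟨⟨c, hc⟩⟩
  have : Nonempty α := ⟨a⟩
  exact ⟨⟨Iio a, isLowerSet_Iio a, ⟨a, by simp⟩, Order.iso_of_countable_dense _ _⟩,
    ⟨Ioi a, isUpperSet_Ioi a, ⟨a, by simp⟩, Order.iso_of_countable_dense _ _⟩⟩

/-- The generic linear order is bicompressible. -/
theorem bicompressible_mem_residual : LOr ∩ LOl ∈ residual LO := by
  filter_upwards [countable_iInter_mem.2 mem_residual_exists_gt,
    countable_iInter_mem.2 mem_residual_exists_lt,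
    countable_iInter_mem.2 fun n => countable_iInter_mem.2 (mem_residual_exists_between n)]
    with L h₁ h₂ h₃
  rw [mem_iInter] at h₁ h₂ h₃
  have : NoMaxOrder (Dom L) := ⟨h₁⟩
  have : NoMinOrder (Dom L) := ⟨h₂⟩
  have : DenselyOrdered (Dom L) := ⟨fun n m hnm => by
    rcases mem_iInter.1 (h₃ n) m with h | h | h
    · exact absurd h hnm.not_gt
    · exact absurd hnm (h ▸ lt_irrefl _)
    · exact h⟩
  exact bicompressible_of_dense (α := Dom L)

/-- One piece is comeagre and the others, being disjoint from it, are meagre. -/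
theorem baireMeasurableSet_piece (i : Fin 4) : BaireMeasurableSet (piece i) := by
  by_cases hi : i = 3
  · subst hi
    exact .of_mem_residual bicompressible_mem_residual
  · refine .of_compl (.of_mem_residual ?_)
    filter_upwards [bicompressible_mem_residual] with L hL hLi
    exact disjoint_left.1 (pairwise_disjoint_piece hi) hLi hL

end Generic

/-! ### Examples in each piece. -/

section Nonempty

theorem rightCompressible_dual {α : Type*} [LinearOrder α] :
    RightCompressible αᵒᵈ ↔ LeftCompressible α :=
  (leftCompressible_dual (α := αᵒᵈ)).symm

theorem not_rightCompressible_of_isSuccArchimedean {α : Type*} [LinearOrder α] [NoMaxOrder α]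
    [Nonempty α] [SuccOrder α] [IsSuccArchimedean α] : ¬ RightCompressible α := by
  rw [rightCompressible_iff]
  rintro ⟨f, -, z, hz⟩
  exact f.strictMono.not_bddAbove_range_of_isSuccArchimedean
    ⟨z, by rintro _ ⟨y, rfl⟩; exact (hz y).le⟩

theorem not_leftCompressible_of_isPredArchimedean {α : Type*} [LinearOrder α] [NoMinOrder α]
    [Nonempty α] [PredOrder α] [IsPredArchimedean α] : ¬ LeftCompressible α := by
  rw [leftCompressible_iff]
  rintro ⟨f, -, z, hz⟩
  exact f.strictMono.not_bddBelow_range_of_isPredArchimedean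
    ⟨z, by rintro _ ⟨y, rfl⟩; exact (hz y).le⟩

theorem leftCompressible_nat : LeftCompressible ℕ := by
  refine leftCompressible_iff.2 ⟨OrderEmbedding.ofStrictMono (· + 1) fun a b h => by simpa using h,
    ⟨?_⟩, 0, fun y => Nat.succ_pos y⟩
  rintro _ ⟨a, rfl⟩ _ ⟨b, rfl⟩ z hz
  have : a + 1 ≤ z := hz.1
  exact ⟨z - 1, show z - 1 + 1 = z by omega⟩

theorem exists_LO_compressible_iff (K : Type) [LinearOrder K] [Countable K] [Infinite K] :
    ∃ L : LO, (L ∈ LOr ↔ RightCompressible K) ∧ (L ∈ LOl ↔ LeftCompressible K) := by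
  obtain ⟨L, ⟨e⟩⟩ := exists_LO_orderIso K
  exact ⟨L, ⟨fun h => h.of_cvxEmb (.of_orderIso e) (.of_orderIso e.symm),
    fun h => h.of_cvxEmb (.of_orderIso e.symm) (.of_orderIso e)⟩,
    ⟨fun h => h.of_cvxEmb (.of_orderIso e) (.of_orderIso e.symm),
    fun h => h.of_cvxEmb (.of_orderIso e.symm) (.of_orderIso e)⟩⟩

theorem nonempty_piece (i : Fin 4) : (piece i).Nonempty := by
  fin_cases i
  · obtain ⟨L, hr, hl⟩ := exists_LO_compressible_iff ℤ
    exact ⟨L, fun h => h.elim (fun h => not_rightCompressible_of_isSuccArchimedean (hr.1 h))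
      fun h => not_leftCompressible_of_isPredArchimedean (hl.1 h)⟩
  · obtain ⟨L, hr, hl⟩ := exists_LO_compressible_iff ℕ
    exact ⟨L, hl.2 leftCompressible_nat,
      fun h => not_rightCompressible_of_isSuccArchimedean (hr.1 h)⟩
  · obtain ⟨L, hr, hl⟩ := exists_LO_compressible_iff ℕᵒᵈ
    exact ⟨L, hr.2 (rightCompressible_dual.2 leftCompressible_nat), fun h =>
      not_rightCompressible_of_isSuccArchimedean (leftCompressible_dual.1 (hl.1 h))⟩
  · obtain ⟨L, hr, hl⟩ := exists_LO_compressible_iff ℚ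
    exact ⟨L, hr.2 bicompressible_of_dense.1, hl.2 bicompressible_of_dense.2⟩

end Nonempty

/-! ### Assembling the reductions. -/

section Main

theorem BorelReducibleOn.trans {X Y Z : Type*} [MeasurableSpace X] [StandardBorelSpace X]
    [MeasurableSpace Y] [StandardBorelSpace Y] [MeasurableSpace Z] [StandardBorelSpace Z]
    {A : Set X} {E : Setoid X} {F : Setoid Y} {G : Setoid Z} (h : BorelReducibleOn A E F)
    (h' : BorelReducible F G) : BorelReducibleOn A E G := by
  obtain ⟨φ, hφ, h⟩ := h
  obtain ⟨ψ, hψ, h'⟩ := h'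
  exact ⟨ψ ∘ φ, hψ.comp hφ, fun x hx y hy => (h x hx y hy).trans (h' _ _)⟩

theorem isBorelReductionOn_incompressible :
    IsBorelReductionOn (LOr ∪ LOl)ᶜ cvxBiembLO isoLO id :=
  ⟨measurable_id, fun _ hL _ _ => cvxBiembLO_iff_isoLO_of_incompressible hL⟩

theorem borelReducibleOn_piece (i : Fin 4) : BorelReducibleOn (piece i) cvxBiembLO isoLO := by
  fin_cases i
  · exact ⟨id, isBorelReductionOn_incompressible⟩
  · exact BorelReducibleOn.trans (exists_reduction_left_only.imp fun _ h => h.2)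
      borelReducible_jump_isoLO
  · exact BorelReducibleOn.trans (exists_reduction_right_only.imp fun _ h => h.2)
      borelReducible_jump_isoLO
  · exact BorelReducibleOn.trans (exists_reduction_bicompressible.imp fun _ h => h.2)
      borelReducible_jump_isoLO

theorem sigmaClassifiable_cvxBiembLO : SigmaClassifiable cvxBiembLO :=
  ⟨Fin 4, inferInstance, piece, pairwise_disjoint_piece, iUnion_piece, fun i =>
    ⟨closedUnder_piece i, baireMeasurableSet_piece i,
      (borelReducibleOn_piece i).trans borelReducible_isoLO_isoGRAPH⟩⟩

/-- Isomorphism of linear orders has Borel self-reductions with pairwise inequivalent values. -/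
theorem exists_tagged_reductions : ∃ τ : ℕ → LO → LO, (∀ j, Measurable (τ j)) ∧
    ∀ i j L M, isoLO (τ i L) (τ j M) ↔ i = j ∧ isoLO L M := by
  have h : ∀ j : ℕ, ∃ φ : LO → LO, Measurable φ ∧
      ∀ L, Nonempty (Dom (φ L) ≃o blocks (fun _ : Dom L => j)) := fun j =>
    exists_code_blocks (W := ℕ) (P := fun L : LO => Dom L) (fun L w => (show Dom L from w))
      (fun L => Function.surjective_id) measurableSet_dom_le (fun L _ => j) fun w i => .const (j = i)
  choose τ hτ hτb using h
  refine ⟨τ, hτ, fun i j L M => ?_⟩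
  obtain ⟨e⟩ := hτb i L
  obtain ⟨e'⟩ := hτb j M
  have h₁ : isoLO (τ i L) (τ j M) ↔
      Nonempty (blocks (fun _ : Dom L => i) ≃o blocks fun _ : Dom M => j) :=
    ⟨fun ⟨F⟩ => ⟨(e.symm.trans F).trans e'⟩, fun ⟨F⟩ => ⟨(e.trans F).trans e'.symm⟩⟩
  rw [h₁, nonempty_blocks_orderIso_iff]
  constructor
  · rintro ⟨f, hf⟩
    exact ⟨(hf (show Dom L from (0 : ℕ))).symm, ⟨f⟩⟩
  · rintro ⟨rfl, ⟨f⟩⟩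
    exact ⟨f, fun _ => rfl⟩

/-- Tags keep values from different pieces non-isomorphic. The glued map inherits from the pieces
only the Baire property, which is why the reduction is not claimed to be Borel. -/
theorem baireReducible_cvxBiembLO_isoLO : BaireReducible cvxBiembLO isoLO := by
  choose φ hφ hφr using borelReducibleOn_piece
  obtain ⟨τ, hτ, hτi⟩ := exists_tagged_reductions
  have hmem : ∀ L, ∃ i, L ∈ piece i := fun L => mem_iUnion.1 (iUnion_piece ▸ mem_univ L)
  choose idx hidx using hmem
  have hidx_eq : ∀ {L i}, L ∈ piece i → idx L = i := fun {L i} h => by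
    by_contra hne
    exact disjoint_left.1 (pairwise_disjoint_piece hne) (hidx L) h
  refine ⟨fun L => τ (idx L) (φ (idx L) L), fun B hB => ?_, fun L M => ?_⟩
  · have : (fun L => τ (idx L) (φ (idx L) L)) ⁻¹' B =
        ⋃ i, piece i ∩ (fun L => τ i (φ i L)) ⁻¹' B := by
      ext L
      simp only [mem_preimage, mem_iUnion, mem_inter_iff]
      constructor
      · exact fun h => ⟨idx L, hidx L, h⟩
      · rintro ⟨i, hi, h⟩
        obtain rfl := hidx_eq hi
        exact h
    rw [this]
    rw [← BorelSpace.measurable_eq (α := LO)] at hB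
    exact .iUnion fun i => (baireMeasurableSet_piece i).inter
      (((hτ i).comp (hφ i)) hB).baireMeasurableSet
  · rw [hτi]
    constructor
    · intro h
      have hidx' : idx L = idx M :=
        (hidx_eq (closedUnder_piece _ M (hidx M) L h))
      refine ⟨congrArg _ hidx', ?_⟩
      rw [← hidx']
      exact (hφr _ L (hidx L) M (hidx' ▸ hidx M)).1 h
    · rintro ⟨h, h'⟩
      have hidx' : idx L = idx M := Fin.ext h
      rw [← hidx'] at h'
      exact (hφr _ L (hidx L) M (hidx' ▸ hidx M)).2 h'

end Main

end CvxBiembed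

theorem corollary3p19 :
    -- classification of convex biembeddability
    SigmaClassifiable cvxBiembLO ∧
    BaireReducible cvxBiembLO isoLO ∧
    -- the four pieces form a partition of `LO` into invariant sets with the Baire property
    (Pairwise (fun i j => Disjoint (piece i) (piece j)) ∧ (⋃ i, piece i) = Set.univ ∧
      (∀ i, (piece i).Nonempty ∧ ClosedUnder cvxBiembLO (piece i) ∧
        BaireMeasurableSet (piece i))) ∧
    -- on the incompressible piece the two relations coincide
    ((∀ L ∈ (LOr ∪ LOl)ᶜ, ∀ M ∈ (LOr ∪ LOl)ᶜ, cvxBiembLO L M ↔ isoLO L M) ∧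
      IsBorelReductionOn (LOr ∪ LOl)ᶜ cvxBiembLO isoLO id) ∧
    -- on the other three pieces: reductions to the jump of isomorphism
    (∃ φ : LO → ℕ → LO, EnumeratesInfinite intervals φ ∧
      IsBorelReductionOn (LOr ∩ LOl) cvxBiembLO (jump isoLO) φ) ∧
    (∃ φ : LO → ℕ → LO, EnumeratesInfinite upperRays φ ∧
      IsBorelReductionOn (LOl \ LOr) cvxBiembLO (jump isoLO) φ) ∧
    (∃ φ : LO → ℕ → LO, EnumeratesInfinite lowerRays φ ∧
      IsBorelReductionOn (LOr \ LOl) cvxBiembLO (jump isoLO) φ) ∧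
    -- the jump of isomorphism reduces to isomorphism, hence so do these three restrictions
    BorelReducible (jump isoLO) isoLO ∧
    BorelReducibleOn (LOr ∩ LOl) cvxBiembLO isoLO ∧
    BorelReducibleOn (LOl \ LOr) cvxBiembLO isoLO ∧
    BorelReducibleOn (LOr \ LOl) cvxBiembLO isoLO := by
  refine ⟨sigmaClassifiable_cvxBiembLO, baireReducible_cvxBiembLO_isoLO,
    ⟨pairwise_disjoint_piece, iUnion_piece, fun i =>
      ⟨nonempty_piece i, closedUnder_piece i, baireMeasurableSet_piece i⟩⟩,
    ⟨fun L hL M _ => cvxBiembLO_iff_isoLO_of_incompressible hL,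
      isBorelReductionOn_incompressible⟩,
    exists_reduction_bicompressible, exists_reduction_left_only, exists_reduction_right_only,
    borelReducible_jump_isoLO, borelReducibleOn_piece 3, borelReducibleOn_piece 1,
    borelReducibleOn_piece 2⟩
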